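/- Let $N\ge 2$ be an integer, $r>0$, $0<t_*<\infty$, $\beta>0$. For $v\in\mathbb C$, $\operatorname{Im}\tau>0$ put $$\vartheta_1(v;\tau)=i\sum_{n\in\mathbb Z}(-1)^n e^{\pi i\tau(n-1/2)^2}e^{\pi i v(2n-1)},$$ and for $t\in[0,t_*)$ let $\tau(t)=\frac{i(t_*-t)}{2\pi r^2}$ and $$U_N(t,x)=-\log\left|\vartheta_1\!\left(\tfrac{x}{2\pi r};N\tau(t)\right)\right|,\qquad x\in\mathbb R\setminus 2\pi r\mathbb Z$$ ($\vartheta_1$ is real here, and positive for $0<x<2\pi r$); $U_N'$, $U_N''$ are the first two $x$-derivatives. For $x=(x_1,\dots,x_N)\in\mathbb R^N$ let $$\overline x=\sum_{j=1}^N x_j-\kappa_N,\quad \kappa_N=\frac{\pi r}{2}\bigl(2N-3+(-1)^N\bigr),\quad W_N(t,x)=\sum_{1\le j<k\le N}U_N(t,x_k-x_j)+U_N(t,\overline x),$$ and let $R_N$ be the set of $x\in\mathbb R^N$ with $\overline x\notin 2\pi r\mathbb Z$ and $x_k-x_j\notin 2\pi r\mathbb Z$ for all $j<k$; it contains all $x$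 with $x_1<\dots<x_N<x_1+2\pi r$ and $0<\overline x<2\pi r$. Let $$\mathcal L_N^{(\beta)}(t)f=\frac12\sum_{j=1}^N\frac{\partial^2 f}{\partial x_j^2}+\frac\beta2\sum_{j=1}^N\frac{\partial}{\partial x_j}\left(\frac{\partial W_N}{\partial x_j}f\right).$$ Let $\zeta$ and $\wp$ be the Weierstrass functions with (full) periods $2\pi r$ and $2N\omega_3(t)=iN(t_*-t)/r$, that is, with lattice $\Lambda=2\pi r\mathbb Z+\frac{iN(t_*-t)}{r}\mathbb Z$, $$\zeta(z)=\frac1z+\sum_{\Omega\in\Lambda\setminus\{0\}}\left[\frac1{z-\Omega}+\frac1\Omega+\frac z{\Omega^2}\right],\qquad \wp(z)=\frac1{z^2}+\sum_{\Omega\in\Lambda\setminus\{0\}}\left[\frac1{(z-\Omega)^2}-\frac1{\Omega^2}\right],$$ and $\eta_1=\zeta(\pi r)$ (these depend on $t$; $\eta_1$ is real). Put $$V_N^{(\beta)}(t,x)=\frac{\beta(\beta-2)}8N\left[\sum_{j<k}U_N'(t,x_k-x_j)^2+U_N'(t,\overline x)^2-\frac{N-2}N\sum_{j<k}U_N''(t,x_k-x_j)\right],$$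 $$E_{N,0}^{(\beta)}(t)=-\frac{\beta^2}{16}N(N-1)(N-2)\frac{1}{\pi r}\eta_1,\qquad \mathcal H_N^{(\beta)}(t)=-\frac12\sum_{j=1}^N\frac{\partial^2}{\partial x_j^2}+V_N^{(\beta)}(t,x).$$ Then, for $t\in[0,t_*)$ and $x\in R_N$: (i) as an identity of operators on functions of $(t,x)$ that are differentiable in $t$ (one-sidedly at $t=0$) and $C^2$ in $x$ (it holds at every point near which the function has this regularity), $$e^{\beta W_N/2}\left[\frac{\partial}{\partial t}-\mathcal L_N^{(\beta)}(t)\right]e^{-\beta W_N/2}=\frac{\partial}{\partial t}+\left(\mathcal H_N^{(\beta)}(t)-E_{N,0}^{(\beta)}(t)\right);$$ (ii) $$V_N^{(\beta)}(t,x)=\frac{\beta(\beta-2)}8N\left[\sum_{j<k}\left(\zeta(x_k-x_j)-\frac{x_k-x_j}{\pi r}\eta_1\right)^2+\left(\zeta(\overline x)-\frac{\overline x}{\pi r}\eta_1\right)^2-\frac{N-2}N\sum_{j<k}\left(\wp(x_k-x_j)+\frac{\eta_1}{\pi r}\right)\right].$$ -/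

import Mathlib

noncomputable section

open Complex in
/-- The Jacobi theta function
`ϑ₁(v; τ) = i ∑_{n ∈ ℤ} (-1)^n q^{(n - 1/2)²} z^{2n - 1}`, with `z = e^{π i v}`, `q = e^{π i τ}`
(absolutely convergent for `Im τ > 0`). -/
def jacobiThetaOne (v τ : ℂ) : ℂ :=
  I * ∑' n : ℤ, (-1) ^ n * exp (Real.pi * I * τ * ((n : ℂ) - 1 / 2) ^ 2)
    * exp (Real.pi * I * v * (2 * (n : ℂ) - 1))

open Complex in
/-- `ϑ₁` is real for real `v` and purely imaginary `τ`. -/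
theorem jacobiThetaOne_conj (v s : ℝ) :
    (starRingEnd ℂ) (jacobiThetaOne v (I * s)) = jacobiThetaOne v (I * s) := by
  unfold jacobiThetaOne
  rw [map_mul, conj_I, conj_tsum, ← (Equiv.subLeft (1 : ℤ)).tsum_eq, neg_mul, ← mul_neg,
    ← tsum_neg]
  congr 2
  funext n
  simp only [Equiv.subLeft_apply, map_mul, ← exp_conj, map_zpow₀, map_neg, map_one, map_pow,
    map_sub, map_div₀, map_ofNat, conj_I, conj_ofReal]
  have h1 : ((-1 : ℂ)) ^ (1 - n) = -(-1) ^ n := by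
    rw [zpow_sub₀ (by norm_num), zpow_one]
    rcases Int.even_or_odd n with h | h
    · simp [h.neg_one_zpow]
    · simp [h.neg_one_zpow]
  have h2 : ∀ m : ℤ, (starRingEnd ℂ) (m : ℂ) = m := fun m => by
    simp
  rw [h1, h2]
  push_cast
  rw [neg_mul, neg_mul, neg_neg]
  have h3 : (Real.pi : ℂ) * -I * (-I * s) * (1 - (n : ℂ) - 1 / 2) ^ 2
      = Real.pi * I * (I * s) * ((n : ℂ) - 1 / 2) ^ 2 := by ring
  have h4 : (Real.pi : ℂ) * -I * v * (2 * (1 - (n : ℂ)) - 1)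
      = Real.pi * I * v * (2 * (n : ℂ) - 1) := by ring
  rw [h3, h4]

/-- `U_N(t, x) = -log ϑ₁(x / (2πr); N τ(t))` with `τ(t) = i (T - t) / (2πr²)`.
For these arguments `ϑ₁` takes real values, so `.re` only changes the type. It is positive
on `(0, 2πr)`; as `Real.log` is `log |·|`, the value elsewhere is `-log |ϑ₁|`. -/
def thetaPotential (N : ℕ) (r T t x : ℝ) : ℝ :=
  -Real.log (jacobiThetaOne (x / (2 * Real.pi * r) : ℝ)
    (Complex.I * (N * (T - t) / (2 * Real.pi * r ^ 2) : ℝ))).re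

/-- `U_N'(t, x)`. -/
def thetaPotential' (N : ℕ) (r T t x : ℝ) : ℝ :=
  deriv (fun y => thetaPotential N r T t y) x

/-- `U_N''(t, x)`. -/
def thetaPotential'' (N : ℕ) (r T t x : ℝ) : ℝ :=
  deriv (fun y => thetaPotential' N r T t y) x

/-- `κ_N = (πr/2) (2N - 3 + (-1)^N)`. -/
def kappaShift (N : ℕ) (r : ℝ) : ℝ :=
  Real.pi * r / 2 * (2 * N - 3 + (-1) ^ N)

/-- The shifted center of mass `x̄ = x_1 + ⋯ + x_N - κ_N`. -/
def shiftedSum {N : ℕ} (r : ℝ) (x : Fin N → ℝ) : ℝ :=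
  ∑ j, x j - kappaShift N r

/-- `W_N(t, x) = ∑_{j < k} U_N(t, x_k - x_j) + U_N(t, x̄)`. -/
def dysonPotential {N : ℕ} (r T t : ℝ) (x : Fin N → ℝ) : ℝ :=
  ∑ j, ∑ k ∈ Finset.Ioi j, thetaPotential N r T t (x k - x j)
    + thetaPotential N r T t (shiftedSum r x)

/-- The configurations at which no term of `W_N` is singular. They contain
the alcove `x_1 < ⋯ < x_N < x_1 + 2πr`, `0 < x̄ < 2πr`. -/
def regularConfigurations (N : ℕ) (r : ℝ) : Set (Fin N → ℝ) :=
  {x | (∀ j k, j < k → ∀ m : ℤ, x k - x j ≠ 2 * Real.pi * r * m) ∧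
    ∀ m : ℤ, shiftedSum r x ≠ 2 * Real.pi * r * m}

/-- The partial derivative `∂f/∂x_j`. -/
def coordDeriv {N : ℕ} (j : Fin N) (f : (Fin N → ℝ) → ℝ) (x : Fin N → ℝ) : ℝ :=
  deriv (fun s => f (Function.update x j s)) (x j)

/-- The time derivative `∂f/∂t` on the time interval `[0, T)` (one-sided at `0`). -/
def timeDeriv {N : ℕ} (T : ℝ) (f : ℝ → (Fin N → ℝ) → ℝ) (t : ℝ) (x : Fin N → ℝ) : ℝ :=
  derivWithin (fun s => f s x) (Set.Ico 0 T) t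

/-- The Kolmogorov operator
`L f = (1/2) ∑_j ∂²f/∂x_j² + (β/2) ∑_j ∂/∂x_j ((∂W_N/∂x_j) f)`. -/
def kolmogorovOp {N : ℕ} (β r T t : ℝ) (f : (Fin N → ℝ) → ℝ) (x : Fin N → ℝ) : ℝ :=
  1 / 2 * ∑ j, coordDeriv j (coordDeriv j f) x
    + β / 2 * ∑ j, coordDeriv j (fun y => coordDeriv j (dysonPotential r T t) y * f y) x

/-- The interaction `V_N^{(β)}(t, x)`, in terms of `U_N'` and `U_N''`. -/
def interaction {N : ℕ} (β r T t : ℝ) (x : Fin N → ℝ) : ℝ :=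
  β * (β - 2) / 8 * N *
    (∑ j, ∑ k ∈ Finset.Ioi j, thetaPotential' N r T t (x k - x j) ^ 2
      + thetaPotential' N r T t (shiftedSum r x) ^ 2
      - ((N : ℝ) - 2) / N
        * ∑ j, ∑ k ∈ Finset.Ioi j, thetaPotential'' N r T t (x k - x j))

/-- The Hamiltonian `H f = -(1/2) ∑_j ∂²f/∂x_j² + V_N^{(β)} f`. -/
def hamiltonianOp {N : ℕ} (β r T t : ℝ) (f : (Fin N → ℝ) → ℝ) (x : Fin N → ℝ) : ℝ :=
  -(1 / 2) * ∑ j, coordDeriv j (coordDeriv j f) x + interaction β r T t x * f x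

/-- The Weierstrass zeta function of the lattice `Λ = ℤ ω₁ + ℤ ω₂`:
`ζ(z) = 1/z + ∑_{l ∈ Λ ∖ {0}} (1/(z - l) + 1/l + z/l²)`.
As `1 / 0 = 0`, the term `l = 0` of the sum below is `1/z`. -/
def PeriodPair.weierstrassZeta (L : PeriodPair) (z : ℂ) : ℂ :=
  ∑' l : L.lattice, (1 / (z - l) + 1 / (l : ℂ) + z / (l : ℂ) ^ 2)

/-- `η₁ = ζ(ω₁/2)`, the value of `ζ` at half of the first (full) period. -/
def PeriodPair.etaOne (L : PeriodPair) : ℂ := L.weierstrassZeta (L.ω₁ / 2)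

/-- The pair of (full) periods `2ω₁ = 2πr` and `2Nω₃(t) = i N (T - t) / r`. -/
def dysonPeriods {N : ℕ} {r T t : ℝ} (hN : 2 ≤ N) (hr : 0 < r) (ht : t < T) : PeriodPair where
  ω₁ := (2 * Real.pi * r : ℝ)
  ω₂ := Complex.I * (N * (T - t) / r : ℝ)
  indep := by
    rw [LinearIndependent.pair_iff]
    intro a b h
    have hN' : (0 : ℝ) < N := by exact_mod_cast (by omega : 0 < N)
    have h1 : 2 * Real.pi * r ≠ 0 := by positivity
    have h2 : N * (T - t) / r ≠ 0 := by
      have : 0 < T - t := sub_pos.2 ht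
      positivity
    have hre := congrArg Complex.re h
    have him := congrArg Complex.im h
    simp only [Complex.real_smul, Complex.add_re, Complex.add_im, Complex.re_ofReal_mul,
      Complex.im_ofReal_mul, Complex.ofReal_re, Complex.ofReal_im, Complex.I_mul_re,
      Complex.I_mul_im, Complex.zero_re, Complex.zero_im, neg_zero, mul_zero, add_zero,
      zero_add] at hre him
    exact ⟨(mul_eq_zero.1 hre).resolve_right h1, (mul_eq_zero.1 him).resolve_right h2⟩

/-- `η₁` is real for these periods. -/
theorem etaOne_dysonPeriods_conj {N : ℕ} {r T t : ℝ} (hN : 2 ≤ N) (hr : 0 < r) (ht : t < T) :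
    (starRingEnd ℂ) (dysonPeriods hN hr ht).etaOne = (dysonPeriods hN hr ht).etaOne := by
  have h1 : (starRingEnd ℂ) (dysonPeriods hN hr ht).ω₁ = (dysonPeriods hN hr ht).ω₁ :=
    Complex.conj_ofReal _
  have h2 : (starRingEnd ℂ) (dysonPeriods hN hr ht).ω₂ = -(dysonPeriods hN hr ht).ω₂ := by
    simp only [dysonPeriods, map_mul, Complex.conj_I, Complex.conj_ofReal, neg_mul]
  generalize dysonPeriods hN hr ht = L at h1 h2
  unfold PeriodPair.etaOne PeriodPair.weierstrassZeta
  rw [Complex.conj_tsum, ← L.latticeEquivProd.symm.toEquiv.tsum_eq,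
    ← ((Equiv.refl ℤ).prodCongr (Equiv.neg ℤ)).tsum_eq,
    ← L.latticeEquivProd.symm.toEquiv.tsum_eq (fun l : L.lattice =>
      1 / (L.ω₁ / 2 - (l : ℂ)) + 1 / (l : ℂ) + L.ω₁ / 2 / (l : ℂ) ^ 2)]
  congr 1
  funext p
  have h3 : ((L.latticeEquivProd.symm.toEquiv p : L.lattice) : ℂ) = p.1 * L.ω₁ + p.2 * L.ω₂ :=
    L.latticeEquiv_symm_apply p
  have h4 : (starRingEnd ℂ) ((L.latticeEquivProd.symm.toEquiv
      (((Equiv.refl ℤ).prodCongr (Equiv.neg ℤ)) p) : L.lattice) : ℂ)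
      = p.1 * L.ω₁ + p.2 * L.ω₂ := by
    rw [show ((L.latticeEquivProd.symm.toEquiv
      (((Equiv.refl ℤ).prodCongr (Equiv.neg ℤ)) p) : L.lattice) : ℂ)
        = (p.1 : ℂ) * L.ω₁ + ((-p.2 : ℤ) : ℂ) * L.ω₂ from L.latticeEquiv_symm_apply _]
    simp [h1, h2]
  simp only [map_add, map_sub, map_div₀, map_one, map_pow, map_ofNat, h1, h3, h4]

/-- The ground energy `E_{N,0}^{(β)}(t) = -(β²/16) N (N-1) (N-2) η₁ / (πr)`
(`η₁` is real, so `.re` only changes the type). -/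
def groundEnergy {N : ℕ} {r T t : ℝ} (β : ℝ) (hN : 2 ≤ N) (hr : 0 < r) (ht : t < T) : ℝ :=
  -(β ^ 2 / 16) * N * ((N : ℝ) - 1) * ((N : ℝ) - 2) * (1 / (Real.pi * r))
    * (dysonPeriods hN hr ht).etaOne.re

end

/-! Conjugation by exp(βW/2) removes the first-order terms and leaves the potential -(β/2)∂ₜW -
(β/4)ΔW + (β²/8)|∇W|². Three facts about U evaluate it.

The heat equation for ϑ₁ gives ∂ₜU = (N/2)(U'² - U''). In ∂ₜW and ΔW the terms U''(x̄) then cancel.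
The logarithmic derivative of ϑ₁ gives U'(x) = -(ζ(x) - xη₁/(πr)), hence U'' = ℘ + η₁/(πr), which is
all that (ii) needs. The addition theorem (ζ(a)+ζ(b)-ζ(a+b))² = ℘(a)+℘(b)+℘(a+b) turns the
three-body terms of |∇W|² into pair sums and a constant; the constant is the ground energy. The
force at x̄ is the same for all coordinates and the pair forces sum to zero, so there are no mixed
terms.

The addition theorem (`weierstrassZeta_addition`) follows from Liouville's theorem: the difference
of the two sides is elliptic with removable singularities and vanishes at 0. For the logarithmic
derivative (`deriv_scaledTheta`), entire functions with the multipliers of ϑ₁ are shown to be its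
multiples, by a recursion for their Fourier coefficients. A combination of θζ, zθ and θ' has these
multipliers and is even, while θ is odd, so it vanishes. The purely algebraic step from the addition
theorem to |∇W|² is `sum_sq_sum_of_addition`. -/

noncomputable section

open Filter Topology

/-! ### The Weierstrass zeta function: derivative, parity, quasi-periods. -/

namespace PeriodPair

variable (L : PeriodPair)

/-- The Weierstrass zeta function with the pole at the origin removed. -/
def weierstrassZetaRegular (z : ℂ) : ℂ :=
  ∑' l : L.lattice, if l.1 = 0 then 0 else (1 / (z - l) + 1 / (l : ℂ) + z / (l : ℂ) ^ 2)

/-- The three fractions combine to s²/((s - l)l²), and |s - l| ≥ |l|/2. Cubic decay is summable over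
a lattice of rank two. -/
theorem norm_zetaTerm_le {r : ℝ} (hr : 0 < r) {s : ℂ} (hs : ‖s‖ < r) {l : ℂ}
    (h : 2 * r ≤ ‖l‖) :
    ‖1 / (s - l) + 1 / l + s / l ^ 2‖ ≤ 2 * r ^ 2 * ‖l‖ ^ (-3 : ℝ) := by
  have hl : 0 < ‖l‖ := by linarith
  have hl0 : l ≠ 0 := norm_pos_iff.1 hl
  have hsl : ‖l‖ / 2 ≤ ‖s - l‖ := by
    rw [norm_sub_rev]
    exact .trans (by linarith) (norm_sub_norm_le l s)
  have hsl0 : s - l ≠ 0 := norm_pos_iff.1 (lt_of_lt_of_le (by positivity) hsl)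
  have e : 1 / (s - l) + 1 / l + s / l ^ 2 = s ^ 2 / ((s - l) * l ^ 2) := by
    field_simp
    ring
  rw [e, norm_div, norm_mul, norm_pow, norm_pow]
  calc ‖s‖ ^ 2 / (‖s - l‖ * ‖l‖ ^ 2) ≤ r ^ 2 / (‖l‖ / 2 * ‖l‖ ^ 2) := by gcongr
    _ = 2 * r ^ 2 / ‖l‖ ^ 3 := by field
    _ = _ := by norm_cast

theorem hasSumLocallyUniformly_weierstrassZetaRegular :
    HasSumLocallyUniformly (fun (l : L.lattice) (z : ℂ) ↦
      if l.1 = 0 then 0 else (1 / (z - l) + 1 / (l : ℂ) + z / (l : ℂ) ^ 2))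
      L.weierstrassZetaRegular := by
  refine L.hasSumLocallyUniformly_aux (u := fun r l ↦ 2 * r ^ 2 * ‖l‖ ^ (-3 : ℝ)) _
    (fun _ _ ↦ (ZLattice.summable_norm_rpow _ _ (by simp; norm_num)).mul_left _) fun r hr ↦
    Filter.eventually_atTop.mpr ⟨2 * r, ?_⟩
  rintro _ h s hs l rfl
  split_ifs
  · simpa using! show 0 ≤ 2 * r ^ 2 * (‖(l : ℂ)‖ ^ 3)⁻¹ by positivity
  · exact norm_zetaTerm_le hr hs h

theorem weierstrassZeta_eq (z : ℂ) :
    L.weierstrassZeta z = 1 / z + L.weierstrassZetaRegular z := by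
  have h := L.hasSumLocallyUniformly_weierstrassZetaRegular.hasSum (x := z)
  have h0 : HasSum (fun l : L.lattice ↦ if l = 0 then 1 / z else 0) (1 / z) :=
    hasSum_ite_eq 0 (1 / z)
  rw [weierstrassZeta, ← (h0.add h).tsum_eq]
  congr with l
  by_cases hl : l = 0
  · simp [hl]
  · simp [hl]

theorem hasDerivAt_zetaTerm {z l : ℂ} (h : z - l ≠ 0) :
    HasDerivAt (fun z : ℂ ↦ 1 / (z - l) + 1 / l + z / l ^ 2) (-(1 / (z - l) ^ 2 - 1 / l ^ 2)) z := by
  have h1 := ((hasDerivAt_id z).sub_const l).inv h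
  have h2 := (h1.add_const (1 / l)).add ((hasDerivAt_id z).div_const (l ^ 2))
  simp only [one_div]
  simp only [one_div] at h2
  refine h2.congr_deriv ?_
  simp
  ring

/-- Locally uniform convergence permits termwise differentiation, and the differentiated terms are
those of -℘ without its pole at 0. -/
theorem hasDerivAt_weierstrassZetaRegular {z : ℂ} (hz : z ∈ ((L.lattice : Set ℂ) \ {0})ᶜ) :
    HasDerivAt L.weierstrassZetaRegular (-L.weierstrassPExcept 0 z) z := by
  have hne (l : L.lattice) (hl : l.1 ≠ 0) (w : ℂ) (hw : w ∈ ((L.lattice : Set ℂ) \ {0})ᶜ) :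
      w - l ≠ 0 := fun e ↦ by
    obtain rfl := sub_eq_zero.1 e
    exact hw ⟨l.2, hl⟩
  have hd (l : L.lattice) (w : ℂ) (hw : w ∈ ((L.lattice : Set ℂ) \ {0})ᶜ) :
      HasDerivAt (fun z : ℂ ↦ if l.1 = 0 then 0 else (1 / (z - l) + 1 / (l : ℂ) + z / (l : ℂ) ^ 2))
        (-(if l.1 = 0 then 0 else (1 / (w - l) ^ 2 - 1 / (l : ℂ) ^ 2))) w := by
    by_cases hl : l.1 = 0
    · simp only [hl, if_true, neg_zero]
      exact hasDerivAt_const _ _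
    · simp only [hl, if_false]
      exact hasDerivAt_zetaTerm (hne l hl w hw)
  have hds (s : Finset L.lattice) (w : ℂ) (hw : w ∈ ((L.lattice : Set ℂ) \ {0})ᶜ) :=
    HasDerivAt.fun_sum (u := s) fun l _ ↦ hd l w hw
  have hT := L.hasSumLocallyUniformly_weierstrassZetaRegular.tendstoLocallyUniformlyOn
    (s := ((L.lattice : Set ℂ) \ {0})ᶜ)
  have hdiff := hT.differentiableOn (.of_forall fun s w hw ↦
    (hds s w hw).differentiableAt.differentiableWithinAt) L.isOpen_compl_lattice_sdiff
  have h1 := hT.deriv (.of_forall fun s w hw ↦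
    (hds s w hw).differentiableAt.differentiableWithinAt) L.isOpen_compl_lattice_sdiff
  have h2 := h1.tendsto_at hz
  have h3 := (L.hasSum_weierstrassPExcept 0 z).neg
  have h4 : deriv L.weierstrassZetaRegular z = -L.weierstrassPExcept 0 z := by
    refine tendsto_nhds_unique h2 (h3.congr ?_)
    intro s
    exact ((hds s z hz).deriv).symm
  rw [← h4]
  exact (hdiff.differentiableAt (L.isOpen_compl_lattice_sdiff.mem_nhds hz)).hasDerivAt

theorem hasDerivAt_weierstrassZeta {z : ℂ} (hz : z ∉ L.lattice) :
    HasDerivAt L.weierstrassZeta (-L.weierstrassP z) z := by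
  have hz0 : z ≠ 0 := fun h ↦ hz (h ▸ zero_mem _)
  have h := (hasDerivAt_inv hz0).add
    (L.hasDerivAt_weierstrassZetaRegular (z := z) fun h ↦ hz h.1)
  have e : L.weierstrassZeta = (fun z ↦ z⁻¹) + L.weierstrassZetaRegular := by
    ext w
    simp [weierstrassZeta_eq]
  rw [e]
  refine h.congr_deriv ?_
  rw [← L.weierstrassPExcept_add 0 z]
  simp

@[simp]
theorem weierstrassZeta_neg (z : ℂ) : L.weierstrassZeta (-z) = -L.weierstrassZeta z := by
  simp only [weierstrassZeta]
  rw [← (Equiv.neg L.lattice).tsum_eq, ← tsum_neg]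
  congr with l
  simp only [Equiv.neg_apply, NegMemClass.coe_neg]
  rw [show -z - -(l : ℂ) = -(z - l) by ring, div_neg, div_neg]
  ring

@[simp]
theorem weierstrassZetaRegular_neg (z : ℂ) :
    L.weierstrassZetaRegular (-z) = -L.weierstrassZetaRegular z := by
  have h := L.weierstrassZeta_neg z
  rw [weierstrassZeta_eq, weierstrassZeta_eq, div_neg] at h
  linear_combination h

@[simp]
theorem weierstrassZetaRegular_zero : L.weierstrassZetaRegular 0 = 0 := by
  simpa [CharZero.eq_neg_self_iff] using L.weierstrassZetaRegular_neg 0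

theorem analyticAt_weierstrassZetaRegular_zero : AnalyticAt ℂ L.weierstrassZetaRegular 0 := by
  refine DifferentiableOn.analyticAt (s := ((L.lattice : Set ℂ) \ {0})ᶜ) (fun w hw ↦
    (L.hasDerivAt_weierstrassZetaRegular hw).differentiableAt.differentiableWithinAt)
    (L.isOpen_compl_lattice_sdiff.mem_nhds (by simp))

theorem analyticAt_weierstrassZeta {z : ℂ} (hz : z ∉ L.lattice) :
    AnalyticAt ℂ L.weierstrassZeta z :=
  DifferentiableOn.analyticAt (s := (L.lattice : Set ℂ)ᶜ) (fun _ hw ↦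
    (L.hasDerivAt_weierstrassZeta hw).differentiableAt.differentiableWithinAt)
    (L.isClosed_lattice.isOpen_compl.mem_nhds hz)

theorem isPreconnected_compl_lattice : IsPreconnected (L.lattice : Set ℂ)ᶜ := by
  refine (Set.Countable.isConnected_compl_of_one_lt_rank (by simp) ?_).2
  exact Set.countable_coe_iff.1 (inferInstanceAs (Countable L.lattice))

/-- The difference of the two sides' zeta values has derivative zero because ℘ is periodic, and the
complement of a countable set in the plane is connected. -/
theorem exists_weierstrassZeta_add (l : L.lattice) :
    ∃ c : ℂ, ∀ z ∉ L.lattice, L.weierstrassZeta (z + l) = L.weierstrassZeta z + c := by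
  have hd (z : ℂ) (hz : z ∈ (L.lattice : Set ℂ)ᶜ) :
      HasDerivAt (fun z ↦ L.weierstrassZeta (z + l) - L.weierstrassZeta z) 0 z := by
    have hz' : z + l ∉ L.lattice := fun h ↦ hz (by simpa using sub_mem h l.2)
    refine (((L.hasDerivAt_weierstrassZeta hz').comp_add_const z l).sub
      (L.hasDerivAt_weierstrassZeta hz)).congr_deriv ?_
    rw [L.weierstrassP_add_coe, sub_self]
  obtain ⟨c, hc⟩ := L.isClosed_lattice.isOpen_compl.exists_is_const_of_deriv_eq_zero
    L.isPreconnected_compl_lattice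
    (fun z hz ↦ (hd z hz).differentiableAt.differentiableWithinAt) (fun z hz ↦ (hd z hz).deriv)
  refine ⟨c, fun z hz ↦ ?_⟩
  have := hc z hz
  linear_combination this

theorem weierstrassZeta_add_ω₁ {z : ℂ} (hz : z ∉ L.lattice) :
    L.weierstrassZeta (z + L.ω₁) = L.weierstrassZeta z + 2 * L.etaOne := by
  obtain ⟨c, hc⟩ := L.exists_weierstrassZeta_add ⟨L.ω₁, L.ω₁_mem_lattice⟩
  -- The point -ω₁/2 is moved to ω₁/2, so oddness identifies the quasi-period as 2ζ(ω₁/2).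
  have h := hc (-(L.ω₁ / 2)) fun h ↦ L.ω₁_div_two_notMem_lattice (by simpa using neg_mem h)
  rw [show -(L.ω₁ / 2) + L.ω₁ = L.ω₁ / 2 by ring, weierstrassZeta_neg] at h
  have h' := hc z hz
  simp only at h'
  rw [h', etaOne]
  linear_combination -h

end PeriodPair

/-! ### Removable singularities, Liouville's theorem and the addition theorem. -/

/-- A function on `ℂ` all of whose singularities are removable agrees with an entire function
near each point, that point itself excepted. -/
theorem exists_entire_extension {f : ℂ → ℂ}
    (hf : ∀ a, ∃ g : ℂ → ℂ, AnalyticAt ℂ g a ∧ f =ᶠ[𝓝[≠] a] g) :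
    ∃ F : ℂ → ℂ, Differentiable ℂ F ∧ ∀ a, f =ᶠ[𝓝[≠] a] F := by
  have key (a : ℂ) (g : ℂ → ℂ) (hg : AnalyticAt ℂ g a) (hfg : f =ᶠ[𝓝[≠] a] g) :
      limUnder (𝓝[≠] a) f = g a :=
    ((hg.continuousAt.tendsto.mono_left nhdsWithin_le_nhds).congr' hfg.symm).limUnder_eq
  have key2 (a : ℂ) (g : ℂ → ℂ) (hg : AnalyticAt ℂ g a) (hfg : f =ᶠ[𝓝[≠] a] g) :
      (fun z ↦ limUnder (𝓝[≠] z) f) =ᶠ[𝓝 a] g := by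
    -- A point z ≠ a near a has a full neighbourhood on which f = g, so the punctured limit of f at
    -- z is g z.
    have h1 : ∀ᶠ z in 𝓝[≠] a, ∀ᶠ w in 𝓝[{a}ᶜ] z, f w = g w :=
      eventually_eventually_nhdsWithin.2 hfg
    rw [eventually_nhdsWithin_iff] at h1
    filter_upwards [h1, hg.eventually_analyticAt] with z hz hz'
    by_cases hza : z = a
    · rw [hza]
      exact key a g hg hfg
    · refine key z g hz' ?_
      have h2 := hz hza
      rw [isOpen_compl_singleton.nhdsWithin_eq (by simpa using hza)] at h2
      exact h2.filter_mono nhdsWithin_le_nhds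
  refine ⟨fun z ↦ limUnder (𝓝[≠] z) f, fun a ↦ ?_, fun a ↦ ?_⟩
  · obtain ⟨g, hg, hfg⟩ := hf a
    exact (hg.differentiableAt.congr_of_eventuallyEq (key2 a g hg hfg))
  · obtain ⟨g, hg, hfg⟩ := hf a
    exact hfg.trans ((key2 a g hg hfg).filter_mono nhdsWithin_le_nhds).symm
theorem tendsto_add_const_nhdsNE (a b : ℂ) : Tendsto (· + b) (𝓝[≠] a) (𝓝[≠] (a + b)) := by
  refine tendsto_nhdsWithin_of_tendsto_nhds_of_eventually_within _
    ((continuous_add_const b).tendsto' a _ rfl |>.mono_left nhdsWithin_le_nhds) ?_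
  filter_upwards [self_mem_nhdsWithin] with z hz h
  exact hz (add_right_cancel h)

theorem tendsto_sub_left_nhdsNE (a b : ℂ) : Tendsto (b - ·) (𝓝[≠] a) (𝓝[≠] (b - a)) := by
  refine tendsto_nhdsWithin_of_tendsto_nhds_of_eventually_within _
    ((continuous_sub_left b).tendsto' a _ rfl |>.mono_left nhdsWithin_le_nhds) ?_
  filter_upwards [self_mem_nhdsWithin] with z hz h
  exact hz (sub_right_injective h)

theorem eq_of_eventuallyEq_nhdsNE {f g : ℂ → ℂ} {a : ℂ} (hf : ContinuousAt f a)
    (hg : ContinuousAt g a) (h : f =ᶠ[𝓝[≠] a] g) : f a = g a :=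
  tendsto_nhds_unique ((hf.tendsto.mono_left nhdsWithin_le_nhds).congr' h)
    (hg.tendsto.mono_left nhdsWithin_le_nhds)

namespace PeriodPair

variable (L : PeriodPair)

theorem eventually_notMem_lattice (a : ℂ) : ∀ᶠ z in 𝓝[≠] a, z ∉ L.lattice := by
  filter_upwards [self_mem_nhdsWithin, mem_nhdsWithin_of_mem_nhds
    (L.compl_lattice_sdiff_singleton_mem_nhds a)] with z hz hz' h
  exact hz' ⟨h, hz⟩

/-- An elliptic function whose singularities are all removable is constant. -/
theorem exists_eq_const_of_periodic {f : ℂ → ℂ}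
    (hf : ∀ a, ∃ g : ℂ → ℂ, AnalyticAt ℂ g a ∧ f =ᶠ[𝓝[≠] a] g)
    (hper : ∀ l ∈ L.lattice, ∀ a, ∀ᶠ z in 𝓝[≠] a, f (z + l) = f z) :
    ∃ c : ℂ, ∀ a, f =ᶠ[𝓝[≠] a] fun _ ↦ c := by
  obtain ⟨F, hF, hfF⟩ := exists_entire_extension hf
  have hFp (z w : ℂ) (hw : w ∈ L.lattice) : F (z + w) = F z := by
    refine eq_of_eventuallyEq_nhdsNE (f := fun z ↦ F (z + w))
      (hF.continuous.comp (continuous_add_const w)).continuousAt hF.continuous.continuousAt ?_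
    have h1 := (tendsto_add_const_nhdsNE z w).eventually (hfF (z + w))
    filter_upwards [h1, hfF z, hper w hw z] with y h1 h2 h3
    rw [← h1, ← h2, h3]
  refine ⟨F 0, fun a ↦ (hfF a).trans (.of_forall fun z ↦ ?_)⟩
  -- A continuous function periodic under the lattice has compact range; Liouville's theorem
  -- applies.
  exact hF.apply_eq_apply_of_bounded (IsZLattice.isCompact_range_of_periodic L.lattice _
    hF.continuous hFp).isBounded z 0

theorem analyticAt_weierstrassPExcept_zero : AnalyticAt ℂ (L.weierstrassPExcept 0) 0 :=
  L.analyticAt_weierstrassPExcept 0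

theorem weierstrassP_eq (z : ℂ) : L.weierstrassP z = 1 / z ^ 2 + L.weierstrassPExcept 0 z := by
  have h := L.weierstrassPExcept_add 0 z
  rw [← h]
  simp
  ring

/-- The addition theorem of the Weierstrass zeta function. -/
theorem weierstrassZeta_addition {a b : ℂ} (ha : a ∉ L.lattice) (hb : b ∉ L.lattice)
    (hab : a + b ∉ L.lattice) :
    (L.weierstrassZeta a + L.weierstrassZeta b - L.weierstrassZeta (a + b)) ^ 2
      = L.weierstrassP a + L.weierstrassP b + L.weierstrassP (a + b) := by
  set F : ℂ → ℂ := fun z ↦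
    (L.weierstrassZeta z + L.weierstrassZeta b - L.weierstrassZeta (z + b)) ^ 2
      - (L.weierstrassP z + L.weierstrassP b + L.weierstrassP (z + b)) with hFdef
  have hanal (z : ℂ) (hz : z ∉ L.lattice) (hzb : z + b ∉ L.lattice) : AnalyticAt ℂ F z := by
    have h1 := L.analyticAt_weierstrassZeta hz
    have h2 : AnalyticAt ℂ (fun z ↦ L.weierstrassZeta (z + b)) z :=
      (L.analyticAt_weierstrassZeta hzb).comp_of_eq (f := fun z ↦ z + b) (by fun_prop) rfl
    have h3 := L.analyticOnNhd_weierstrassP z hz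
    have h4 : AnalyticAt ℂ (fun z ↦ L.weierstrassP (z + b)) z :=
      (L.analyticOnNhd_weierstrassP _ hzb).comp_of_eq (f := fun z ↦ z + b) (by fun_prop) rfl
    exact (((h1.add analyticAt_const).sub h2).pow 2).sub ((h3.add analyticAt_const).add h4)
  have hper (l : ℂ) (hl : l ∈ L.lattice) (z : ℂ) (hz : z ∉ L.lattice) (hzb : z + b ∉ L.lattice) :
      F (z + l) = F z := by
    obtain ⟨c, hc⟩ := L.exists_weierstrassZeta_add ⟨l, hl⟩
    have e1 := hc z hz
    have e2 := hc _ hzb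
    have e3 := L.weierstrassP_add_coe z ⟨l, hl⟩
    have e4 := L.weierstrassP_add_coe (z + b) ⟨l, hl⟩
    simp only at e1 e2 e3 e4
    simp only [hFdef]
    rw [show z + l + b = z + b + l by ring, e1, e2, e3, e4]
    ring
  -- This reflection exchanges the singularities at the lattice with those at its translate by -b,
  -- so only the lattice points need a local analysis.
  have hsymm (z : ℂ) : F (-b - z) = F z := by
    simp only [hFdef]
    rw [show -b - z + b = -z by ring, show -b - z = -(z + b) by ring]
    simp only [weierstrassZeta_neg, weierstrassP_neg]
    ring
  -- Near 0 the bracket is 1/z + u with u analytic and u(0) = 0. The square contributes 1/z² + 2u/z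
  -- + u², and the double pole cancels that of ℘. The value at 0 is 2u'(0) - 2℘(b) = 0, since u'(0)
  -- = ℘(b).
  obtain ⟨g, hg, hFg, hg0⟩ : ∃ g : ℂ → ℂ, AnalyticAt ℂ g 0 ∧ F =ᶠ[𝓝[≠] 0] g ∧ g 0 = 0 := by
    set u : ℂ → ℂ := fun z ↦ L.weierstrassZetaRegular z + L.weierstrassZeta b
      - L.weierstrassZeta (z + b) with hu
    have h2 : AnalyticAt ℂ (fun z ↦ L.weierstrassZeta (z + b)) 0 :=
      (L.analyticAt_weierstrassZeta hb).comp_of_eq (f := fun z ↦ z + b) (by fun_prop) (by simp)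
    have h4 : AnalyticAt ℂ (fun z ↦ L.weierstrassP (z + b)) 0 :=
      (L.analyticOnNhd_weierstrassP _ hb).comp_of_eq (f := fun z ↦ z + b) (by fun_prop) (by simp)
    have hua : AnalyticAt ℂ u 0 :=
      (L.analyticAt_weierstrassZetaRegular_zero.add analyticAt_const).sub h2
    have hu0 : u 0 = 0 := by simp [hu]
    have hud : HasDerivAt u (L.weierstrassP b) 0 := by
      have h5 := L.hasDerivAt_weierstrassZetaRegular (z := 0) (by simp)
      have h6 := (L.hasDerivAt_weierstrassZeta (z := 0 + b) (by simpa using hb)).comp_add_const 0 b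
      refine ((h5.add_const _).sub h6).congr_deriv ?_
      simp
    refine ⟨fun z ↦ 2 * dslope u 0 z + u z ^ 2 - L.weierstrassPExcept 0 z - L.weierstrassP b
      - L.weierstrassP (z + b), ?_, ?_, ?_⟩
    · have h7 : AnalyticAt ℂ (dslope u 0) 0 :=
        let ⟨_, hp⟩ := hua
        (HasFPowerSeriesAt.has_fpower_series_dslope_fslope hp).analyticAt
      exact ((((analyticAt_const.mul h7).add (hua.pow 2)).sub
        L.analyticAt_weierstrassPExcept_zero).sub analyticAt_const).sub h4
    · filter_upwards [self_mem_nhdsWithin] with z hz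
      have hz : z ≠ 0 := hz
      simp only [hFdef]
      rw [dslope_of_ne _ hz, slope_def_field, hu0, L.weierstrassZeta_eq z, L.weierstrassP_eq z]
      simp only [hu]
      field
    · simp [hud.deriv, hu0]
      ring
  have hl0 (l : ℂ) (hl : l ∈ L.lattice) :
      ∃ g : ℂ → ℂ, AnalyticAt ℂ g l ∧ F =ᶠ[𝓝[≠] l] g := by
    refine ⟨fun z ↦ g (z - l), hg.comp_of_eq (f := fun z ↦ z - l) (by fun_prop) (by simp), ?_⟩
    have h1 := (tendsto_add_const_nhdsNE l (-l)).eventually (by rwa [add_neg_cancel])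
    have h2 := (tendsto_add_const_nhdsNE l b).eventually (L.eventually_notMem_lattice _)
    filter_upwards [h1, h2, L.eventually_notMem_lattice l] with z h1 h2 h3
    rw [← sub_eq_add_neg] at h1
    rw [← h1, sub_eq_add_neg]
    exact (hper (-l) (neg_mem hl) z h3 h2).symm
  obtain ⟨c, hc⟩ := L.exists_eq_const_of_periodic (f := F) (fun z ↦ by
    by_cases hz : z ∈ L.lattice
    · exact hl0 z hz
    by_cases hzb : z + b ∈ L.lattice
    · obtain ⟨g', hg', hFg'⟩ := hl0 (-b - z) (by
        rw [show -b - z = -(z + b) by ring]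
        exact neg_mem hzb)
      refine ⟨fun w ↦ g' (-b - w), hg'.comp (f := fun w ↦ -b - w) (by fun_prop), ?_⟩
      filter_upwards [(tendsto_sub_left_nhdsNE z (-b)).eventually hFg'] with w hw
      rw [← hw, hsymm]
    · exact ⟨F, hanal z hz hzb, .rfl⟩) (fun l hl z ↦ by
    have h2 := (tendsto_add_const_nhdsNE z b).eventually (L.eventually_notMem_lattice _)
    filter_upwards [h2, L.eventually_notMem_lattice z] with w h2 h3
    exact hper l hl w h3 h2)
  have hc0 : c = 0 := by
    have := eq_of_eventuallyEq_nhdsNE continuousAt_const hg.continuousAt ((hc 0).symm.trans hFg)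
    rw [this, hg0]
  have := eq_of_eventuallyEq_nhdsNE (hanal a ha hab).continuousAt continuousAt_const (hc a)
  rw [hc0] at this
  exact sub_eq_zero.1 this

end PeriodPair

end

/-! ### Uniqueness of entire functions with theta quasi-periodicity. -/

noncomputable section

open Filter Topology Complex

/-- A periodic entire function with vanishing Fourier coefficients vanishes. -/
theorem eq_zero_of_fourier_integrals {g : ℂ → ℂ} (hg : Differentiable ℂ g)
    (hper : ∀ z, g (z + 1) = g z)
    (h0 : ∀ n : ℤ, ∫ x in (0 : ℝ)..1, g x * exp (-(2 * Real.pi * I * n * x)) = 0) : g = 0 := by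
  have hp : Function.Periodic (fun x : ℝ ↦ g x) 1 := fun x ↦ by
    simpa using hper x
  have hc : Continuous (fun x : ℝ ↦ g x) := hg.continuous.comp continuous_ofReal
  let G : C(AddCircle (1 : ℝ), ℂ) := ⟨hp.lift, continuous_coinduced_dom.mpr hc⟩
  have hG (x : ℝ) : G x = g x := hp.lift_coe x
  have hcoef : fourierCoeff G = 0 := by
    ext n
    rw [fourierCoeff_eq_intervalIntegral _ _ 0]
    simp only [Pi.zero_apply, hG, zero_add, fourier_coe_apply, smul_eq_mul]
    rw [show (∫ x in (0 : ℝ)..1, exp (2 * Real.pi * I * (-n : ℤ) * x / (1 : ℝ)) * g x)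
        = ∫ x in (0 : ℝ)..1, g x * exp (-(2 * Real.pi * I * n * x)) from
      intervalIntegral.integral_congr fun x _ ↦ by
        simp only [ofReal_one, div_one, Int.cast_neg]
        rw [mul_comm]
        ring_nf, h0, smul_zero]
  -- The zero coefficients are trivially summable, so the Fourier series converges pointwise to the
  -- function on the real line; the identity theorem then leaves the line.
  have hreal (x : ℝ) : g x = 0 := by
    have h := has_pointwise_sum_fourier_series_of_summable (f := G)
      (by rw [hcoef]; exact summable_zero) x
    rw [hcoef, hG] at h
    simpa using h.unique (by simp)
  have hfr : ∃ᶠ z in 𝓝[≠] (0 : ℂ), g z = 0 := by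
    have ht : Tendsto (fun x : ℝ ↦ (x : ℂ)) (𝓝[≠] 0) (𝓝[≠] 0) := by
      refine tendsto_nhdsWithin_of_tendsto_nhds_of_eventually_within _
        ((continuous_ofReal.tendsto' 0 0 (by simp)).mono_left nhdsWithin_le_nhds) ?_
      filter_upwards [self_mem_nhdsWithin] with x hx
      simpa using hx
    exact ht.frequently (Eventually.of_forall hreal).frequently
  have := AnalyticOnNhd.eq_of_frequently_eq (g := 0)
    (fun z _ ↦ hg.analyticAt z) (fun z _ ↦ analyticAt_const) (z₀ := 0) (by simpa using hfr)
  exact this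

/-- A periodic entire function has the same mean over all horizontal periods. -/
theorem integral_add_mul_I_of_periodic {F : ℂ → ℂ} (hF : Differentiable ℂ F)
    (hper : ∀ z, F (z + 1) = F z) (s : ℝ) :
    ∫ x in (0 : ℝ)..1, F (x + s * I) = ∫ x in (0 : ℝ)..1, F x := by
  -- Cauchy's theorem on the rectangle with corners 0 and 1 + si; its vertical sides cancel by
  -- periodicity.
  have h := integral_boundary_rect_eq_zero_of_differentiableOn F 0 (1 + s * I) hF.differentiableOn
  have e (y : ℝ) : F (1 + y * I) = F (y * I) := by rw [add_comm, hper]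
  simp [e] at h
  linear_combination -h

/-- Entire functions with the quasi-periodicity of the theta function are determined by their
mean over the horizontal period. -/
theorem eq_zero_of_quasiPeriodic {s : ℝ} {g : ℂ → ℂ} (hg : Differentiable ℂ g)
    (h1 : ∀ z, g (z + 1) = g z)
    (h2 : ∀ z, g (z + I * s) = exp (-Real.pi * I * (I * s + 2 * z)) * g z)
    (h0 : ∫ x in (0 : ℝ)..1, g x = 0) : g = 0 := by
  set c : ℤ → ℂ := fun n ↦ ∫ x in (0 : ℝ)..1, g x * exp (-(2 * Real.pi * I * n * x)) with hc
  -- Moving the contour of the n-th coefficient up by si brings in the multiplier, whose factor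
  -- exp(-2πiz) raises the index by one. The other factor is nonzero, so the recursion runs in both
  -- directions from c 0.
  have hrec (n : ℤ) : c n = exp (Real.pi * s + 2 * Real.pi * n * s) * c (n + 1) := by
    have hd : Differentiable ℂ fun z ↦ g z * exp (-(2 * Real.pi * I * n * z)) := by fun_prop
    have h := integral_add_mul_I_of_periodic hd (fun z ↦ by
      rw [h1, show -(2 * Real.pi * I * n * (z + 1))
        = -(2 * Real.pi * I * n * z) - n * (2 * Real.pi * I) by ring, exp_sub,
        exp_int_mul_two_pi_mul_I, div_one]) s
    rw [hc]
    simp only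
    rw [← h, ← intervalIntegral.integral_const_mul]
    refine intervalIntegral.integral_congr fun x _ ↦ ?_
    have e : exp (-Real.pi * I * (I * s + 2 * x)) * exp (-(2 * Real.pi * I * n * (x + I * s)))
        = exp (Real.pi * s + 2 * Real.pi * n * s)
          * exp (-(2 * Real.pi * I * (n + 1 : ℤ) * x)) := by
      rw [← exp_add, ← exp_add]
      congr 1
      push_cast
      ring_nf
      rw [I_sq]
      ring
    rw [mul_comm (s : ℂ) I, h2]
    linear_combination g x * e
  have hc0 : c 0 = 0 := by simpa [hc] using h0
  refine eq_zero_of_fourier_integrals hg h1 fun n ↦ ?_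
  change c n = 0
  induction n using Int.induction_on with
  | zero => exact hc0
  | succ n ih =>
    rw [hrec] at ih
    exact (mul_eq_zero.1 ih).resolve_left (exp_ne_zero _)
  | pred n ih => rw [hrec, sub_add_cancel, ih, mul_zero]

/-- At z = 0 with purely imaginary modulus every term of the series is a positive real exponential.
-/
theorem jacobiTheta₂_zero_ne_zero {s : ℝ} (hs : 0 < s) : jacobiTheta₂ 0 (I * s) ≠ 0 := by
  have h := hasSum_re (hasSum_jacobiTheta₂_term 0 (τ := I * s) (by simpa using hs))
  have e (n : ℤ) : (jacobiTheta₂_term n 0 (I * s)).re = Real.exp (-(Real.pi * n ^ 2 * s)) := by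
    rw [jacobiTheta₂_term, show 2 * (Real.pi : ℂ) * I * n * 0 + Real.pi * I * n ^ 2 * (I * s)
      = ((-(Real.pi * n ^ 2 * s) : ℝ) : ℂ) by push_cast; ring_nf; rw [I_sq]; ring, exp_ofReal_re]
  simp only [e] at h
  intro h0
  rw [h0, zero_re] at h
  have := h.summable.tsum_pos (fun _ ↦ (Real.exp_pos _).le) 0 (Real.exp_pos _)
  rw [h.tsum_eq] at this
  exact this.ne rfl

/-- Subtracting the multiple of θ₂ with the same mean leaves a function of mean zero. The mean of θ₂
is nonzero, as otherwise θ₂ itself would vanish identically. -/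
theorem exists_eq_const_mul_jacobiTheta₂ {s : ℝ} (hs : 0 < s) {g : ℂ → ℂ}
    (hg : Differentiable ℂ g) (h1 : ∀ z, g (z + 1) = g z)
    (h2 : ∀ z, g (z + I * s) = exp (-Real.pi * I * (I * s + 2 * z)) * g z) :
    ∃ c, ∀ z, g z = c * jacobiTheta₂ z (I * s) := by
  have hτ : 0 < im (I * s) := by simpa using hs
  set θ : ℂ → ℂ := fun z ↦ jacobiTheta₂ z (I * s)
  have hθ : Differentiable ℂ θ := fun z ↦ differentiableAt_jacobiTheta₂_fst z hτ
  set m : ℂ := ∫ x in (0 : ℝ)..1, θ x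
  have hm : m ≠ 0 := fun h ↦ jacobiTheta₂_zero_ne_zero hs (congrFun (eq_zero_of_quasiPeriodic hθ
    (fun z ↦ jacobiTheta₂_add_left z _) (fun z ↦ jacobiTheta₂_add_left' z _) h) 0)
  set k : ℂ := (∫ x in (0 : ℝ)..1, g x) / m with hk
  refine ⟨k, fun z ↦ sub_eq_zero.1 ?_⟩
  refine congrFun (eq_zero_of_quasiPeriodic (s := s) (g := fun z ↦ g z - k * θ z)
    (hg.sub (hθ.const_mul k)) (fun z ↦ ?_) (fun z ↦ ?_) ?_) z
  · rw [h1]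
    simp only [θ, jacobiTheta₂_add_left]
  · rw [h2]
    simp only [θ, jacobiTheta₂_add_left']
    ring
  · have i1 : IntervalIntegrable (fun x : ℝ ↦ g x) MeasureTheory.volume 0 1 :=
      (hg.continuous.comp continuous_ofReal).intervalIntegrable _ _
    have i2 : IntervalIntegrable (fun x : ℝ ↦ k * θ x) MeasureTheory.volume 0 1 :=
      (continuous_const.mul (hθ.continuous.comp continuous_ofReal)).intervalIntegrable _ _
    rw [intervalIntegral.integral_sub i1 i2, intervalIntegral.integral_const_mul, hk,
      div_mul_cancel₀ _ hm, sub_self]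

/-- Expanding (n - 1/2)² and writing (-1)ⁿ = exp(πin) shifts the argument of θ₂ by 1/2 - τ/2. -/
theorem jacobiThetaOne_eq (v τ : ℂ) :
    jacobiThetaOne v τ = I * exp (Real.pi * I * τ / 4 - Real.pi * I * v)
      * jacobiTheta₂ (v + 1 / 2 - τ / 2) τ := by
  rw [jacobiThetaOne, jacobiTheta₂, mul_assoc I, ← tsum_mul_left (f := fun n ↦ jacobiTheta₂_term n _ τ)]
  congr 2
  funext n
  have h : ((-1 : ℂ)) ^ n = exp (Real.pi * I * n) := by
    rw [mul_comm, exp_int_mul, exp_pi_mul_I]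
  rw [h, jacobiTheta₂_term, ← exp_add, ← exp_add, ← exp_add]
  congr 1
  ring

theorem differentiable_jacobiThetaOne {τ : ℂ} (hτ : 0 < τ.im) :
    Differentiable ℂ fun v ↦ jacobiThetaOne v τ := by
  have h : Differentiable ℂ fun z ↦ jacobiTheta₂ z τ := fun z ↦
    differentiableAt_jacobiTheta₂_fst z hτ
  have h2 : Differentiable ℂ fun v ↦ jacobiTheta₂ (v + 1 / 2 - τ / 2) τ :=
    h.comp (g := fun z ↦ jacobiTheta₂ z τ) (f := fun v ↦ v + 1 / 2 - τ / 2) (by fun_prop)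
  simp only [jacobiThetaOne_eq]
  fun_prop

theorem jacobiThetaOne_neg (v τ : ℂ) : jacobiThetaOne (-v) τ = -jacobiThetaOne v τ := by
  rw [jacobiThetaOne, jacobiThetaOne, ← (Equiv.subLeft (1 : ℤ)).tsum_eq, ← mul_neg, ← tsum_neg]
  congr 2
  funext n
  have h1 : ((-1 : ℂ)) ^ (1 - n) = -(-1) ^ n := by
    rw [zpow_sub₀ (by norm_num), zpow_one]
    rcases Int.even_or_odd n with h | h
    · simp [h.neg_one_zpow]
    · simp [h.neg_one_zpow]
  rw [Equiv.subLeft_apply, h1, neg_mul, neg_mul]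
  push_cast
  ring_nf

theorem jacobiThetaOne_add_one (v τ : ℂ) : jacobiThetaOne (v + 1) τ = -jacobiThetaOne v τ := by
  rw [jacobiThetaOne_eq, jacobiThetaOne_eq, show v + 1 + 1 / 2 - τ / 2 = v + 1 / 2 - τ / 2 + 1 by
    ring, jacobiTheta₂_add_left, show Real.pi * I * τ / 4 - Real.pi * I * (v + 1)
    = Real.pi * I * τ / 4 - Real.pi * I * v - Real.pi * I by ring, exp_sub _ (Real.pi * I),
    exp_pi_mul_I]
  ring

theorem jacobiThetaOne_add_tau (v τ : ℂ) :
    jacobiThetaOne (v + τ) τ = -exp (-Real.pi * I * (τ + 2 * v)) * jacobiThetaOne v τ := by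
  rw [jacobiThetaOne_eq, jacobiThetaOne_eq, show v + τ + 1 / 2 - τ / 2 = v + 1 / 2 - τ / 2 + τ by
    ring, jacobiTheta₂_add_left']
  have e : exp (Real.pi * I * τ / 4 - Real.pi * I * (v + τ))
        * exp (-Real.pi * I * (τ + 2 * (v + 1 / 2 - τ / 2)))
      = -exp (-Real.pi * I * (τ + 2 * v)) * exp (Real.pi * I * τ / 4 - Real.pi * I * v) := by
    rw [← exp_add, neg_mul (exp _), ← exp_add, show Real.pi * I * τ / 4 - Real.pi * I * (v + τ)
      + -Real.pi * I * (τ + 2 * (v + 1 / 2 - τ / 2)) = -Real.pi * I * (τ + 2 * v)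
      + (Real.pi * I * τ / 4 - Real.pi * I * v) - Real.pi * I by ring, exp_sub _ (Real.pi * I),
      exp_pi_mul_I]
    ring
  linear_combination I * jacobiTheta₂ (v + 1 / 2 - τ / 2) τ * e

theorem jacobiThetaOne_ne_zero {s : ℝ} (hs : 0 < s) : ∃ v, jacobiThetaOne v (I * s) ≠ 0 := by
  -- At this point the shifted argument of θ₂ is 0.
  refine ⟨-1 / 2 + I * s / 2, ?_⟩
  rw [jacobiThetaOne_eq, show -1 / 2 + I * (s : ℂ) / 2 + 1 / 2 - I * s / 2 = 0 by ring]
  exact mul_ne_zero (mul_ne_zero I_ne_zero (exp_ne_zero _)) (jacobiTheta₂_zero_ne_zero hs)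

/-- The entire functions with the quasi-periodicity of `ϑ₁` are the multiples of `ϑ₁`. -/
theorem exists_eq_const_mul_jacobiThetaOne {s : ℝ} (hs : 0 < s) {f : ℂ → ℂ}
    (hf : Differentiable ℂ f) (h1 : ∀ v, f (v + 1) = -f v)
    (h2 : ∀ v, f (v + I * s) = -exp (-Real.pi * I * (I * s + 2 * v)) * f v) :
    ∃ c, ∀ v, f v = c * jacobiThetaOne v (I * s) := by
  obtain ⟨c, hc⟩ := exists_eq_const_mul_jacobiTheta₂ hs
    -- The shift and the exponential undo those of `jacobiThetaOne_eq`, so g acquires the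
    -- multipliers of θ₂.
    (g := fun z ↦ f (z - 1 / 2 + I * s / 2) * exp (Real.pi * I * z))
    ((hf.comp (f := fun z : ℂ ↦ z - 1 / 2 + I * s / 2) (by fun_prop)).mul (by fun_prop))
    (fun z ↦ by
      rw [show z + 1 - 1 / 2 + I * (s : ℂ) / 2 = z - 1 / 2 + I * s / 2 + 1 by ring, h1, mul_add,
        exp_add, mul_one, exp_pi_mul_I]
      ring)
    (fun z ↦ by
      rw [show z + I * (s : ℂ) - 1 / 2 + I * s / 2 = z - 1 / 2 + I * s / 2 + I * s by ring, h2]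
      have e : exp (-Real.pi * I * (I * s + 2 * (z - 1 / 2 + I * s / 2)))
          * exp (Real.pi * I * (z + I * s))
          = -exp (-Real.pi * I * (I * s + 2 * z)) * exp (Real.pi * I * z) := by
        rw [← exp_add, neg_mul (exp _), ← exp_add,
          show -Real.pi * I * (I * s + 2 * (z - 1 / 2 + I * s / 2)) + Real.pi * I * (z + I * s)
            = -Real.pi * I * (I * s + 2 * z) + Real.pi * I * z + Real.pi * I by ring,
          exp_add _ (Real.pi * I), exp_pi_mul_I]
        ring
      linear_combination -f (z - 1 / 2 + I * s / 2) * e)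
  refine ⟨c * (I * exp (Real.pi * I * (I * s) / 4 + Real.pi * I * (1 / 2 - I * s / 2)))⁻¹,
    fun v ↦ ?_⟩
  have h := hc (v + 1 / 2 - I * s / 2)
  rw [show v + 1 / 2 - I * (s : ℂ) / 2 - 1 / 2 + I * s / 2 = v by ring] at h
  have e : exp (Real.pi * I * (I * s) / 4 - Real.pi * I * v)
      * exp (Real.pi * I * (v + 1 / 2 - I * s / 2))
      = exp (Real.pi * I * (I * s) / 4 + Real.pi * I * (1 / 2 - I * s / 2)) := by
    rw [← exp_add]
    congr 1
    ring
  rw [jacobiThetaOne_eq, ← e]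
  have h3 := exp_ne_zero (Real.pi * I * (I * s) / 4 - Real.pi * I * v)
  have h4 := exp_ne_zero (Real.pi * I * (v + 1 / 2 - I * s / 2))
  have h5 := I_ne_zero
  revert h h3 h4
  generalize exp (Real.pi * I * (I * s) / 4 - Real.pi * I * v) = A
  generalize exp (Real.pi * I * (v + 1 / 2 - I * s / 2)) = B
  generalize jacobiTheta₂ (v + 1 / 2 - I * s / 2) (I * s) = J
  intro h h3 h4
  field_simp
  linear_combination h

end

/-! ### The logarithmic derivative and the zeros of the theta function. -/

noncomputable section

open Filter Topology Complex

theorem AnalyticAt.dslope_self {f : ℂ → ℂ} {a : ℂ} (hf : AnalyticAt ℂ f a) :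
    AnalyticAt ℂ (dslope f a) a :=
  let ⟨_, hp⟩ := hf
  (HasFPowerSeriesAt.has_fpower_series_dslope_fslope hp).analyticAt

namespace PeriodPair

variable (L : PeriodPair)

theorem ω₁_ne_zero : L.ω₁ ≠ 0 := by
  simpa using L.indep.ne_zero 0

/-- `ϑ₁`, scaled to the period `ω₁`, for the modulus `I * s`. -/
def scaledTheta (s : ℝ) (z : ℂ) : ℂ := jacobiThetaOne (z / L.ω₁) (I * s)

variable {L} {s : ℝ}

theorem differentiable_scaledTheta (hs : 0 < s) : Differentiable ℂ (L.scaledTheta s) :=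
  (differentiable_jacobiThetaOne (τ := I * s) (by simpa using hs)).comp
    (f := fun z : ℂ ↦ z / L.ω₁) (by fun_prop)

theorem scaledTheta_neg (z : ℂ) : L.scaledTheta s (-z) = -L.scaledTheta s z := by
  rw [scaledTheta, neg_div, jacobiThetaOne_neg, scaledTheta]

theorem scaledTheta_zero : L.scaledTheta s 0 = 0 := by
  simpa [CharZero.eq_neg_self_iff] using scaledTheta_neg (L := L) (s := s) 0

theorem scaledTheta_add_ω₁ (z : ℂ) : L.scaledTheta s (z + L.ω₁) = -L.scaledTheta s z := by
  rw [scaledTheta, add_div, div_self L.ω₁_ne_zero, jacobiThetaOne_add_one, scaledTheta]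

theorem scaledTheta_add_ω₂ (hL : L.ω₂ = L.ω₁ * (I * s)) (z : ℂ) :
    L.scaledTheta s (z + L.ω₂)
      = -exp (-Real.pi * I * (I * s + 2 * (z / L.ω₁))) * L.scaledTheta s z := by
  rw [scaledTheta, add_div, hL, mul_div_cancel_left₀ _ L.ω₁_ne_zero, jacobiThetaOne_add_tau,
    scaledTheta]

/-- The translations that multiply θ by the exponential of an affine function form a subgroup, so
the two generators suffice. This carries local statements at 0 to all lattice points. -/
theorem exists_scaledTheta_add (hL : L.ω₂ = L.ω₁ * (I * s)) {l : ℂ} (hl : l ∈ L.lattice) :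
    ∃ a b : ℂ, ∀ z, L.scaledTheta s (z + l) = exp (a * z + b) * L.scaledTheta s z := by
  let S : AddSubgroup ℂ :=
    { carrier := {l | ∃ a b : ℂ, ∀ z, L.scaledTheta s (z + l) = exp (a * z + b) * L.scaledTheta s z}
      zero_mem' := ⟨0, 0, fun z ↦ by simp⟩
      add_mem' := by
        rintro l l' ⟨a, b, h⟩ ⟨a', b', h'⟩
        refine ⟨a + a', a' * l + b + b', fun z ↦ ?_⟩
        rw [← add_assoc, h', h, ← mul_assoc, ← exp_add]
        ring_nf
      neg_mem' := by
        rintro l ⟨a, b, h⟩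
        refine ⟨-a, a * l - b, fun z ↦ ?_⟩
        have := h (z + -l)
        rw [neg_add_cancel_right] at this
        rw [this, ← mul_assoc, ← exp_add]
        ring_nf
        simp }
  have h1 : L.ω₁ ∈ S := ⟨0, Real.pi * I, fun z ↦ by
    rw [scaledTheta_add_ω₁, zero_mul, zero_add, exp_pi_mul_I]
    ring⟩
  have h2 : L.ω₂ ∈ S := ⟨-Real.pi * I * 2 / L.ω₁, -Real.pi * I * (I * s) + Real.pi * I, fun z ↦ by
    rw [scaledTheta_add_ω₂ hL, ← add_assoc, exp_add _ (Real.pi * I), exp_pi_mul_I]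
    ring_nf⟩
  obtain ⟨m, n, rfl⟩ := mem_lattice.1 hl
  have := S.add_mem (S.zsmul_mem h1 m) (S.zsmul_mem h2 n)
  simp only [zsmul_eq_mul] at this
  exact this

/-- The functions with removable singularities and the quasi-periodicity of the theta function
are its multiples. -/
theorem exists_eq_const_mul_scaledTheta (hs : 0 < s) (hL : L.ω₂ = L.ω₁ * (I * s)) {f : ℂ → ℂ}
    (hf : ∀ a, ∃ g : ℂ → ℂ, AnalyticAt ℂ g a ∧ f =ᶠ[𝓝[≠] a] g)
    (h1 : ∀ z ∉ L.lattice, f (z + L.ω₁) = -f z)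
    (h2 : ∀ z ∉ L.lattice,
      f (z + L.ω₂) = -exp (-Real.pi * I * (I * s + 2 * (z / L.ω₁))) * f z) :
    ∃ c, ∀ a, f =ᶠ[𝓝[≠] a] fun z ↦ c * L.scaledTheta s z := by
  obtain ⟨F, hF, hfF⟩ := exists_entire_extension hf
  have hFc := hF.continuous
  have hω := L.ω₁_ne_zero
  have hF1 (z : ℂ) : F (z + L.ω₁) = -F z := by
    refine eq_of_eventuallyEq_nhdsNE (f := fun z ↦ F (z + L.ω₁)) (g := fun z ↦ -F z)
      (by fun_prop) (by fun_prop) ?_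
    filter_upwards [(tendsto_add_const_nhdsNE z _).eventually (hfF (z + L.ω₁)), hfF z,
      L.eventually_notMem_lattice z] with w e1 e2 e3
    rw [← e1, ← e2, h1 w e3]
  have hF2 (z : ℂ) : F (z + L.ω₂) = -exp (-Real.pi * I * (I * s + 2 * (z / L.ω₁))) * F z := by
    refine eq_of_eventuallyEq_nhdsNE (f := fun z ↦ F (z + L.ω₂))
      (g := fun z ↦ -exp (-Real.pi * I * (I * s + 2 * (z / L.ω₁))) * F z)
      (by fun_prop) (by fun_prop) ?_
    filter_upwards [(tendsto_add_const_nhdsNE z _).eventually (hfF (z + L.ω₂)), hfF z,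
      L.eventually_notMem_lattice z] with w e1 e2 e3
    rw [← e1, ← e2, h2 w e3]
  obtain ⟨c, hc⟩ := exists_eq_const_mul_jacobiThetaOne hs (f := fun v ↦ F (L.ω₁ * v))
    (hF.comp (f := fun v ↦ L.ω₁ * v) (by fun_prop))
    (fun v ↦ by rw [mul_add, mul_one, hF1])
    (fun v ↦ by rw [mul_add, ← hL, hF2, mul_div_cancel_left₀ _ hω])
  refine ⟨c, fun a ↦ (hfF a).trans (.of_forall fun z ↦ ?_)⟩
  have := hc (z / L.ω₁)
  rw [mul_div_cancel₀ _ hω] at this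
  exact this

theorem eventually_scaledTheta_ne_zero (hs : 0 < s) (a : ℂ) :
    ∀ᶠ z in 𝓝[≠] a, L.scaledTheta s z ≠ 0 := by
  have hd := differentiable_scaledTheta (L := L) hs
  refine (hd.analyticAt a).eventually_eq_zero_or_eventually_ne_zero.resolve_left fun h ↦ ?_
  obtain ⟨v, hv⟩ := jacobiThetaOne_ne_zero hs
  refine hv ?_
  have := AnalyticOnNhd.eq_of_eventuallyEq (g := 0) (fun z _ ↦ hd.analyticAt z)
    (fun z _ ↦ analyticAt_const) h
  have := congrFun this (L.ω₁ * v)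
  rwa [scaledTheta, mul_div_cancel_left₀ _ L.ω₁_ne_zero] at this

/-- Removability of the singularity at the origin carries over to the other lattice points. -/
theorem exists_analyticAt_of_lattice {f : ℂ → ℂ} {l : ℂ} {g m k : ℂ → ℂ} (hg : AnalyticAt ℂ g 0)
    (hfg : f =ᶠ[𝓝[≠] 0] g) (hm : AnalyticAt ℂ m l) (hk : AnalyticAt ℂ k l)
    (h : ∀ᶠ z in 𝓝[≠] l, f z = m z * f (z - l) + k z) :
    ∃ g : ℂ → ℂ, AnalyticAt ℂ g l ∧ f =ᶠ[𝓝[≠] l] g := by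
  refine ⟨fun z ↦ m z * g (z - l) + k z,
    (hm.mul (hg.comp_of_eq (f := fun z ↦ z - l) (by fun_prop) (by simp))).add hk, ?_⟩
  have h1 := (tendsto_add_const_nhdsNE l (-l)).eventually (by rwa [add_neg_cancel])
  filter_upwards [h, h1] with z e1 e2
  rw [e1]
  simp only [← sub_eq_add_neg] at e2
  rw [e2]

theorem eventually_scaledTheta_mul_weierstrassZeta :
    (fun z ↦ L.scaledTheta s z * L.weierstrassZeta z) =ᶠ[𝓝[≠] 0]
      fun z ↦ dslope (L.scaledTheta s) 0 z + L.scaledTheta s z * L.weierstrassZetaRegular z := by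
  filter_upwards [self_mem_nhdsWithin] with z hz
  rw [dslope_of_ne _ hz, slope_def_field, scaledTheta_zero, weierstrassZeta_eq]
  simp only [sub_zero]
  ring

/-- The zero of θ at 0 absorbs the simple pole of ζ, and quasi-periodicity moves this to the other
lattice points. -/
theorem removable_scaledTheta_mul_weierstrassZeta (hs : 0 < s) (hL : L.ω₂ = L.ω₁ * (I * s))
    (a : ℂ) : ∃ g : ℂ → ℂ, AnalyticAt ℂ g a ∧
      (fun z ↦ L.scaledTheta s z * L.weierstrassZeta z) =ᶠ[𝓝[≠] a] g := by
  have hd := differentiable_scaledTheta (L := L) hs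
  by_cases ha : a ∈ L.lattice
  · obtain ⟨α, β, h⟩ := exists_scaledTheta_add hL ha
    obtain ⟨c, hc⟩ := L.exists_weierstrassZeta_add ⟨a, ha⟩
    refine exists_analyticAt_of_lattice (m := fun z ↦ exp (α * (z - a) + β))
      (k := fun z ↦ c * L.scaledTheta s z)
      ((hd.analyticAt 0).dslope_self.add
        ((hd.analyticAt 0).mul L.analyticAt_weierstrassZetaRegular_zero))
      eventually_scaledTheta_mul_weierstrassZeta (by fun_prop)
      (analyticAt_const.mul (hd.analyticAt a)) ?_
    filter_upwards [L.eventually_notMem_lattice a] with z hz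
    have e1 := h (z - a)
    have e2 := hc (z - a) fun h ↦ hz (by simpa using add_mem h ha)
    simp only [sub_add_cancel] at e1 e2
    rw [e2]
    linear_combination L.weierstrassZeta (z - a) * e1
  · exact ⟨_, (hd.analyticAt a).mul (L.analyticAt_weierstrassZeta ha), .rfl⟩

theorem eventually_scaledTheta_mul_weierstrassP (h0 : deriv (L.scaledTheta s) 0 = 0) :
    (fun z ↦ L.scaledTheta s z * L.weierstrassP z) =ᶠ[𝓝[≠] 0]
      fun z ↦ dslope (dslope (L.scaledTheta s) 0) 0 z
        + L.scaledTheta s z * L.weierstrassPExcept 0 z := by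
  filter_upwards [self_mem_nhdsWithin] with z hz
  have hz0 : z ≠ 0 := hz
  rw [dslope_of_ne _ hz, slope_def_field, dslope_of_ne _ hz, slope_def_field, scaledTheta_zero,
    dslope_same, h0, weierstrassP_eq]
  simp only [sub_zero]
  field

theorem removable_scaledTheta_mul_weierstrassP (hs : 0 < s) (hL : L.ω₂ = L.ω₁ * (I * s))
    (h0 : deriv (L.scaledTheta s) 0 = 0) (a : ℂ) : ∃ g : ℂ → ℂ, AnalyticAt ℂ g a ∧
      (fun z ↦ L.scaledTheta s z * L.weierstrassP z) =ᶠ[𝓝[≠] a] g := by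
  have hd := differentiable_scaledTheta (L := L) hs
  by_cases ha : a ∈ L.lattice
  · obtain ⟨α, β, h⟩ := exists_scaledTheta_add hL ha
    refine exists_analyticAt_of_lattice (m := fun z ↦ exp (α * (z - a) + β)) (k := 0)
      ((hd.analyticAt 0).dslope_self.dslope_self.add
        ((hd.analyticAt 0).mul L.analyticAt_weierstrassPExcept_zero))
      (eventually_scaledTheta_mul_weierstrassP h0) (by fun_prop) analyticAt_const ?_
    filter_upwards with z
    have e1 := h (z - a)
    have e2 := L.weierstrassP_sub_coe z ⟨a, ha⟩
    simp only [sub_add_cancel] at e1 e2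
    simp only [Pi.zero_apply]
    rw [e2]
    linear_combination L.weierstrassP z * e1
  · exact ⟨_, (hd.analyticAt a).mul (L.analyticOnNhd_weierstrassP a ha), .rfl⟩

/-- If the zero at 0 were multiple, it would absorb the double pole of ℘. Then θ℘ would be entire
with the multipliers of θ, hence cθ, and ℘ would be constant. -/
theorem deriv_scaledTheta_zero_ne_zero (hs : 0 < s) (hL : L.ω₂ = L.ω₁ * (I * s)) :
    deriv (L.scaledTheta s) 0 ≠ 0 := by
  intro h0
  obtain ⟨c, hc⟩ := exists_eq_const_mul_scaledTheta hs hL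
    (removable_scaledTheta_mul_weierstrassP hs hL h0)
    (fun z _ ↦ by
      have e := L.weierstrassP_add_coe z ⟨L.ω₁, L.ω₁_mem_lattice⟩
      simp only at e
      rw [e, scaledTheta_add_ω₁]
      ring)
    (fun z _ ↦ by
      have e := L.weierstrassP_add_coe z ⟨L.ω₂, L.ω₂_mem_lattice⟩
      simp only at e
      rw [e, scaledTheta_add_ω₂ hL]
      ring)
  -- The equation ℘ = c multiplied by z²; at z = 0 it reads 1 = 0.
  have h1 : (fun z ↦ 1 + z ^ 2 * L.weierstrassPExcept 0 z) =ᶠ[𝓝[≠] 0] fun z ↦ c * z ^ 2 := by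
    filter_upwards [hc 0, eventually_scaledTheta_ne_zero (L := L) hs 0, self_mem_nhdsWithin]
      with z e1 e2 hz
    have hz : z ≠ 0 := hz
    have e3 : L.weierstrassP z = c := mul_left_cancel₀ e2 (by linear_combination e1)
    rw [weierstrassP_eq] at e3
    rw [← e3]
    field
  have := L.analyticAt_weierstrassPExcept_zero.continuousAt
  have := eq_of_eventuallyEq_nhdsNE (by fun_prop) (by fun_prop) h1
  simp at this

theorem deriv_scaledTheta_neg (z : ℂ) :
    deriv (L.scaledTheta s) (-z) = deriv (L.scaledTheta s) z := by
  have h := deriv_comp_neg (L.scaledTheta s) z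
  simp only [scaledTheta_neg, deriv.fun_neg] at h
  linear_combination h

theorem deriv_scaledTheta_add_ω₁ (z : ℂ) :
    deriv (L.scaledTheta s) (z + L.ω₁) = -deriv (L.scaledTheta s) z := by
  have h := deriv_comp_add_const (L.scaledTheta s) L.ω₁ z
  simp only [scaledTheta_add_ω₁, deriv.fun_neg] at h
  exact h.symm

theorem deriv_scaledTheta_add_ω₂ (hs : 0 < s) (hL : L.ω₂ = L.ω₁ * (I * s)) (z : ℂ) :
    deriv (L.scaledTheta s) (z + L.ω₂) = -exp (-Real.pi * I * (I * s + 2 * (z / L.ω₁))) *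
      (deriv (L.scaledTheta s) z - 2 * Real.pi * I / L.ω₁ * L.scaledTheta s z) := by
  have h := deriv_comp_add_const (L.scaledTheta s) L.ω₂ z
  simp only [scaledTheta_add_ω₂ hL] at h
  rw [← h]
  have h1 : HasDerivAt (fun z ↦ -Real.pi * I * (I * s + 2 * (z / L.ω₁)))
      (-Real.pi * I * (2 * (1 / L.ω₁))) z :=
    ((((hasDerivAt_id z).div_const _).const_mul 2).const_add _).const_mul _
  have h2 := h1.cexp.fun_neg.fun_mul (differentiable_scaledTheta (L := L) hs z).hasDerivAt
  rw [h2.deriv]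
  ring

/-- The logarithmic derivative of the theta function. -/
theorem deriv_scaledTheta (hs : 0 < s) (hL : L.ω₂ = L.ω₁ * (I * s)) {z : ℂ} (hz : z ∉ L.lattice) :
    deriv (L.scaledTheta s) z
      = L.scaledTheta s z * (L.weierstrassZeta z - 2 * L.etaOne / L.ω₁ * z) := by
  have hω := L.ω₁_ne_zero
  have hd := differentiable_scaledTheta (L := L) hs
  have hd' (a : ℂ) : AnalyticAt ℂ (deriv (L.scaledTheta s)) a := (hd.analyticAt a).deriv
  obtain ⟨c, hc⟩ := L.exists_weierstrassZeta_add ⟨L.ω₂, L.ω₂_mem_lattice⟩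
  simp only at hc
  -- The choice of α cancels the quasi-period of ζ along ω₁. The choice of k cancels the defect c +
  -- αω₂ along ω₂ against the extra term in the translate of θ'.
  set α : ℂ := -(2 * L.etaOne / L.ω₁) with hα
  set k : ℂ := -(c + α * L.ω₂) * L.ω₁ / (2 * Real.pi * I) with hk
  set f : ℂ → ℂ := fun z ↦ L.scaledTheta s z * L.weierstrassZeta z
    + α * z * L.scaledTheta s z - k * deriv (L.scaledTheta s) z with hf
  have hrem (a : ℂ) {g : ℂ → ℂ} (hg : AnalyticAt ℂ g a) : AnalyticAt ℂ (fun z ↦ g z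
      + α * z * L.scaledTheta s z - k * deriv (L.scaledTheta s) z) a :=
    (hg.add ((analyticAt_const.mul analyticAt_id).mul (hd.analyticAt a))).sub
      (analyticAt_const.mul (hd' a))
  obtain ⟨b, hb⟩ := exists_eq_const_mul_scaledTheta hs hL (f := f)
    (fun a ↦ by
      obtain ⟨g, hg, h⟩ := removable_scaledTheta_mul_weierstrassZeta hs hL a
      refine ⟨_, hrem a hg, ?_⟩
      filter_upwards [h] with z e
      simp only [hf, e])
    (fun z hz ↦ by
      simp only [hf]
      rw [deriv_scaledTheta_add_ω₁, scaledTheta_add_ω₁, L.weierstrassZeta_add_ω₁ hz, hα]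
      field)
    (fun z hz ↦ by
      have e : k * (2 * Real.pi * I / L.ω₁) = -(c + α * L.ω₂) := by
        have : (Real.pi : ℂ) ≠ 0 := by exact_mod_cast Real.pi_ne_zero
        have := I_ne_zero
        rw [hk]
        field
      simp only [hf]
      rw [deriv_scaledTheta_add_ω₂ hs hL, scaledTheta_add_ω₂ hL, hc z hz]
      generalize exp (-Real.pi * I * (I * s + 2 * (z / L.ω₁))) = m
      linear_combination -m * L.scaledTheta s z * e)
  have hfan {z : ℂ} (hz : z ∉ L.lattice) : AnalyticAt ℂ f z :=
    hrem z ((hd.analyticAt z).mul (L.analyticAt_weierstrassZeta hz))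
  have hfb {z : ℂ} (hz : z ∉ L.lattice) : f z = b * L.scaledTheta s z :=
    eq_of_eventuallyEq_nhdsNE (hfan hz).continuousAt
      (continuous_const.mul hd.continuous).continuousAt (hb z)
  -- The function f is even and θ is odd, so f = bθ forces f = 0.
  have hf0 {z : ℂ} (hz : z ∉ L.lattice) : f z = 0 := by
    have e1 := hfb hz
    have e2 := hfb (z := -z) fun h ↦ hz (by simpa using neg_mem h)
    have e3 : f (-z) = f z := by
      simp only [hf, scaledTheta_neg, deriv_scaledTheta_neg, weierstrassZeta_neg]
      ring
    rw [e3, scaledTheta_neg] at e2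
    linear_combination (e1 + e2) / 2
  -- At 0 the identity f = 0 becomes (1 - k)θ'(0) = 0. With the definition of k this amounts to
  -- Legendre's relation, which is thus obtained rather than assumed.
  have hk1 : k = 1 := by
    have h1 : (fun z ↦ (dslope (L.scaledTheta s) 0 z
        + L.scaledTheta s z * L.weierstrassZetaRegular z)
        + α * z * L.scaledTheta s z - k * deriv (L.scaledTheta s) z) =ᶠ[𝓝[≠] 0] fun _ ↦ 0 := by
      filter_upwards [eventually_scaledTheta_mul_weierstrassZeta (L := L) (s := s),
        L.eventually_notMem_lattice 0] with z e1 e2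
      rw [← e1]
      exact hf0 e2
    have h2 := eq_of_eventuallyEq_nhdsNE (hrem 0 ((hd.analyticAt 0).dslope_self.add
        ((hd.analyticAt 0).mul L.analyticAt_weierstrassZetaRegular_zero))).continuousAt
        continuousAt_const h1
    simp only [Pi.add_apply, Pi.mul_apply, dslope_same, scaledTheta_zero] at h2
    refine mul_right_cancel₀ (deriv_scaledTheta_zero_ne_zero hs hL) ?_
    linear_combination -h2
  have := hf0 hz
  simp only [hf, hk1, hα] at this
  linear_combination -this

/-- By θ' = θψ with ψ analytic off the lattice, the order of θ' is at least that of θ; at a zero of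
finite order it would drop by one. -/
theorem scaledTheta_ne_zero (hs : 0 < s) (hL : L.ω₂ = L.ω₁ * (I * s)) {z : ℂ}
    (hz : z ∉ L.lattice) : L.scaledTheta s z ≠ 0 := by
  intro h0
  have hd := (differentiable_scaledTheta (L := L) hs).analyticAt z
  have hψ : AnalyticAt ℂ (fun z ↦ L.weierstrassZeta z - 2 * L.etaOne / L.ω₁ * z) z :=
    (L.analyticAt_weierstrassZeta hz).sub (analyticAt_const.mul analyticAt_id)
  have h1 : deriv (L.scaledTheta s) =ᶠ[𝓝 z] L.scaledTheta s *
      fun z ↦ L.weierstrassZeta z - 2 * L.etaOne / L.ω₁ * z := by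
    filter_upwards [L.isClosed_lattice.isOpen_compl.mem_nhds hz] with w hw
    exact deriv_scaledTheta hs hL hw
  have h2 := hd.analyticOrderAt_deriv_add_one
  have h3 := analyticOrderAt_congr h1
  rw [analyticOrderAt_mul hd hψ] at h3
  have h4 : analyticOrderAt (L.scaledTheta s) z ≠ ⊤ := fun h ↦ by
    have h5 := (analyticOrderAt_eq_top.1 h).filter_mono (nhdsWithin_le_nhds (s := {z}ᶜ))
    obtain ⟨w, hw, hw'⟩ := (h5.and (eventually_scaledTheta_ne_zero (L := L) hs z)).exists
    exact hw' hw
  simp only [h0, sub_zero] at h2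
  rw [h3] at h2
  revert h2 h4
  generalize analyticOrderAt (L.scaledTheta s) z = m
  generalize analyticOrderAt (fun z ↦ L.weierstrassZeta z - 2 * L.etaOne / L.ω₁ * z) z = n
  intro h4 h2
  lift m to ℕ using h4
  induction n using ENat.recTopCoe with
  | top => simp at h2
  | coe n =>
    norm_cast at h2
    omega

end PeriodPair
end

/-! ### The heat equation. -/

noncomputable section

open Filter Topology Complex

/-- The second `z`-derivative of `jacobiTheta₂`, as a series. -/
def jacobiTheta₂Second (z τ : ℂ) : ℂ :=
  ∑' n : ℤ, (2 * Real.pi * I * n) ^ 2 * jacobiTheta₂_term n z τ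

/-- Termwise, πin² = (2πin)²/(4πi). -/
theorem jacobiTheta₂_fderiv_zero_one (z : ℂ) {τ : ℂ} (hτ : 0 < im τ) :
    jacobiTheta₂_fderiv z τ (0, 1) = jacobiTheta₂Second z τ / (4 * Real.pi * I) := by
  have h := (hasSum_jacobiTheta₂_term_fderiv z hτ).mapL
    (ContinuousLinearMap.apply ℂ ℂ ((0, 1) : ℂ × ℂ))
  rw [jacobiTheta₂Second, ← tsum_div_const]
  refine (h.tsum_eq.symm.trans ?_)
  congr 1
  funext n
  have : (Real.pi : ℂ) ≠ 0 := by exact_mod_cast Real.pi_ne_zero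
  have := I_ne_zero
  simp [jacobiTheta₂_term_fderiv, jacobiTheta₂_term]
  field

theorem jacobiTheta₂_fderiv_one_zero (z : ℂ) {τ : ℂ} (hτ : 0 < im τ) :
    jacobiTheta₂_fderiv z τ (1, 0) = jacobiTheta₂' z τ := by
  have h : HasDerivAt (fun x ↦ jacobiTheta₂ x τ) ((jacobiTheta₂_fderiv z τ) (1, 0)) z :=
    (((hasFDerivAt_jacobiTheta₂ z hτ).comp z (hasFDerivAt_prodMk_left z τ)).hasDerivAt :)
  exact h.unique (hasDerivAt_jacobiTheta₂_fst z hτ)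

/-- Termwise differentiation on a horizontal strip around z, where the quadratically weighted terms
have a summable bound. -/
theorem hasDerivAt_jacobiTheta₂' (z : ℂ) {τ : ℂ} (hτ : 0 < im τ) :
    HasDerivAt (fun z ↦ jacobiTheta₂' z τ) (jacobiTheta₂Second z τ) z := by
  obtain ⟨S, hz⟩ := exists_gt |im z|
  have hVo : IsOpen {u : ℂ | |im u| < S} :=
    (_root_.continuous_abs.comp continuous_im).isOpen_preimage _ isOpen_Iio
  have hVp : IsPreconnected {u : ℂ | |im u| < S} := by
    refine Convex.isPreconnected ?_
    simpa only [abs_lt] using! (convex_halfSpace_im_gt _).inter (convex_halfSpace_im_lt _)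
  have hu := (summable_pow_mul_jacobiTheta₂_term_bound S hτ 2).mul_left ((2 * Real.pi) ^ 2)
  refine hasDerivAt_tsum_of_isPreconnected (g := fun n z ↦ jacobiTheta₂'_term n z τ)
    (g' := fun n z ↦ (2 * Real.pi * I * n) ^ 2 * jacobiTheta₂_term n z τ) hu hVo hVp
    (fun n y _ ↦ ?_) (fun n y hy ↦ ?_) hz ((summable_jacobiTheta₂'_term_iff z τ).2 hτ) hz
  · have h1 : HasDerivAt (fun y ↦ 2 * Real.pi * I * n * y + Real.pi * I * n ^ 2 * τ)
        (2 * Real.pi * I * n * 1) y := ((hasDerivAt_id y).const_mul _).add_const _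
    refine (h1.cexp.const_mul (2 * Real.pi * I * n)).congr_deriv ?_
    rw [jacobiTheta₂_term]
    ring
  · rw [norm_mul, norm_pow]
    have e : ‖2 * (Real.pi : ℂ) * I * n‖ = 2 * Real.pi * |n| := by
      simp [abs_of_pos Real.pi_pos]
    rw [e, mul_pow, mul_assoc]
    gcongr
    exact norm_jacobiTheta₂_term_le hτ hy.le le_rfl n

/-- The first `v`-derivative of `ϑ₁`. -/
def jacobiThetaOneDeriv (v τ : ℂ) : ℂ :=
  I * exp (Real.pi * I * τ / 4 - Real.pi * I * v) *
    (jacobiTheta₂' (v + 1 / 2 - τ / 2) τ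
      - Real.pi * I * jacobiTheta₂ (v + 1 / 2 - τ / 2) τ)

/-- The second `v`-derivative of `ϑ₁`. -/
def jacobiThetaOneSecond (v τ : ℂ) : ℂ :=
  I * exp (Real.pi * I * τ / 4 - Real.pi * I * v) *
    (jacobiTheta₂Second (v + 1 / 2 - τ / 2) τ
      - 2 * Real.pi * I * jacobiTheta₂' (v + 1 / 2 - τ / 2) τ
      + (Real.pi * I) ^ 2 * jacobiTheta₂ (v + 1 / 2 - τ / 2) τ)

theorem hasDerivAt_jacobiThetaOne_prefactor (v τ : ℂ) :
    HasDerivAt (fun v ↦ I * exp (Real.pi * I * τ / 4 - Real.pi * I * v))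
      (-(Real.pi * I) * (I * exp (Real.pi * I * τ / 4 - Real.pi * I * v))) v := by
  have h : HasDerivAt (fun v ↦ Real.pi * I * τ / 4 - Real.pi * I * v) (-(Real.pi * I * 1)) v :=
    ((hasDerivAt_id v).const_mul _).const_sub _
  refine (h.cexp.const_mul I).congr_deriv ?_
  ring

theorem hasDerivAt_jacobiThetaOne (v : ℂ) {τ : ℂ} (hτ : 0 < im τ) :
    HasDerivAt (fun v ↦ jacobiThetaOne v τ) (jacobiThetaOneDeriv v τ) v := by
  have hs : HasDerivAt (fun v : ℂ ↦ v + 1 / 2 - τ / 2) 1 v :=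
    ((hasDerivAt_id v).add_const _).sub_const _
  have h := (hasDerivAt_jacobiThetaOne_prefactor v τ).mul
    ((hasDerivAt_jacobiTheta₂_fst (v + 1 / 2 - τ / 2) hτ).comp v hs)
  simp only [jacobiThetaOne_eq]
  refine h.congr_deriv ?_
  simp only [Function.comp, jacobiThetaOneDeriv]
  ring

theorem hasDerivAt_jacobiThetaOneDeriv (v : ℂ) {τ : ℂ} (hτ : 0 < im τ) :
    HasDerivAt (fun v ↦ jacobiThetaOneDeriv v τ) (jacobiThetaOneSecond v τ) v := by
  have hs : HasDerivAt (fun v : ℂ ↦ v + 1 / 2 - τ / 2) 1 v :=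
    ((hasDerivAt_id v).add_const _).sub_const _
  have h := (hasDerivAt_jacobiThetaOne_prefactor v τ).mul
    (((hasDerivAt_jacobiTheta₂' (v + 1 / 2 - τ / 2) hτ).comp v hs).sub
      (((hasDerivAt_jacobiTheta₂_fst (v + 1 / 2 - τ / 2) hτ).comp v hs).const_mul
        (Real.pi * I)))
  refine h.congr_deriv ?_
  simp only [Function.comp, jacobiThetaOneSecond, Pi.sub_apply]
  ring

/-- The heat equation for `ϑ₁`. -/
theorem hasDerivAt_jacobiThetaOne_tau (v : ℂ) {τ : ℂ} (hτ : 0 < im τ) :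
    HasDerivAt (fun τ ↦ jacobiThetaOne v τ) (jacobiThetaOneSecond v τ / (4 * Real.pi * I)) τ := by
  have hpi : (Real.pi : ℂ) ≠ 0 := by exact_mod_cast Real.pi_ne_zero
  have hI := I_ne_zero
  have hc : HasDerivAt (fun τ : ℂ ↦ (v + 1 / 2 - τ / 2, τ)) ((-(1 / 2), 1) : ℂ × ℂ) τ :=
    (((hasDerivAt_id τ).div_const 2).const_sub (v + 1 / 2)).prodMk (hasDerivAt_id τ)
  have h1 := (hasFDerivAt_jacobiTheta₂ (v + 1 / 2 - τ / 2) hτ).comp_hasDerivAt_of_eq τ hc rfl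
  -- The modulus also enters the first argument through -τ/2, so the total derivative is ∂τ -
  -- (1/2)∂z; the extra first-order term supplies the one in the second derivative of ϑ₁.
  have e : ((-(1 / 2), 1) : ℂ × ℂ) = (-(1 / 2) : ℂ) • ((1, 0) : ℂ × ℂ) + (0, 1) := by simp
  rw [e, map_add, map_smul, jacobiTheta₂_fderiv_one_zero _ hτ, jacobiTheta₂_fderiv_zero_one _ hτ]
    at h1
  have h2 : HasDerivAt (fun τ ↦ I * exp (Real.pi * I * τ / 4 - Real.pi * I * v))
      (Real.pi * I / 4 * (I * exp (Real.pi * I * τ / 4 - Real.pi * I * v))) τ := by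
    have h : HasDerivAt (fun τ ↦ Real.pi * I * τ / 4 - Real.pi * I * v) (Real.pi * I * 1 / 4) τ :=
      (((hasDerivAt_id τ).const_mul _).div_const 4).sub_const _
    refine (h.cexp.const_mul I).congr_deriv ?_
    ring
  simp only [jacobiThetaOne_eq]
  refine (h2.mul h1).congr_deriv ?_
  simp only [Function.comp, jacobiThetaOneSecond, smul_eq_mul]
  field_simp
  rw [I_sq]
  ring

end

/-! ### Derivatives of the potential in x and t, and its addition theorem. -/

noncomputable section

open Filter Topology Complex

section Potential

variable {N : ℕ} {r T t : ℝ} (hN : 2 ≤ N) (hr : 0 < r) (ht : t < T)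

theorem dysonPeriods_ω₁ : (dysonPeriods hN hr ht).ω₁ = 2 * Real.pi * r := by
  simp [dysonPeriods]

theorem dysonPeriods_ω₂ : (dysonPeriods hN hr ht).ω₂
    = (dysonPeriods hN hr ht).ω₁ * (I * (N * (T - t) / (2 * Real.pi * r ^ 2) : ℝ)) := by
  have hpi : (Real.pi : ℂ) ≠ 0 := by exact_mod_cast Real.pi_ne_zero
  have hr' : (r : ℂ) ≠ 0 := by exact_mod_cast hr.ne'
  simp only [dysonPeriods]
  push_cast
  field

theorem modulus_pos {N : ℕ} {r T t : ℝ} (hN : 2 ≤ N) (hr : 0 < r) (ht : t < T) :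
    0 < N * (T - t) / (2 * Real.pi * r ^ 2) := by
  have hN' : (0 : ℝ) < N := by exact_mod_cast (by omega : 0 < N)
  have : 0 < T - t := sub_pos.2 ht
  have := Real.pi_pos
  positivity

theorem ofReal_notMem_lattice {x : ℝ} (hx : ∀ m : ℤ, x ≠ 2 * Real.pi * r * m) :
    (x : ℂ) ∉ (dysonPeriods hN hr ht).lattice := by
  intro h
  obtain ⟨m, n, h⟩ := PeriodPair.mem_lattice.1 h
  have := congrArg Complex.re h
  refine hx m ?_
  simp [dysonPeriods] at this
  linarith

/-- The odd quasi-periodic function `ζ(z) - z η₁ / (πr)`. -/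
def periodicZeta (z : ℂ) : ℂ :=
  (dysonPeriods hN hr ht).weierstrassZeta z - z / (Real.pi * r) * (dysonPeriods hN hr ht).etaOne

theorem hasDerivAt_periodicZeta {z : ℂ} (hz : z ∉ (dysonPeriods hN hr ht).lattice) :
    HasDerivAt (periodicZeta hN hr ht) (-((dysonPeriods hN hr ht).weierstrassP z
      + 1 / (Real.pi * r) * (dysonPeriods hN hr ht).etaOne)) z := by
  refine (((dysonPeriods hN hr ht).hasDerivAt_weierstrassZeta hz).sub
    (((hasDerivAt_id z).div_const _).mul_const _)).congr_deriv ?_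
  ring

/-- The real theta function whose logarithm defines the potential. -/
def realTheta (N : ℕ) (r T t x : ℝ) : ℝ :=
  (jacobiThetaOne (x / (2 * Real.pi * r) : ℝ)
    (I * (N * (T - t) / (2 * Real.pi * r ^ 2) : ℝ))).re

theorem ofReal_realTheta (N : ℕ) (r T t x : ℝ) : (realTheta N r T t x : ℂ)
    = jacobiThetaOne (x / (2 * Real.pi * r) : ℝ)
      (I * (N * (T - t) / (2 * Real.pi * r ^ 2) : ℝ)) :=
  conj_eq_iff_re.1 (jacobiThetaOne_conj _ _)

theorem ofReal_realTheta_eq_scaledTheta (x : ℝ) : (realTheta N r T t x : ℂ)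
    = (dysonPeriods hN hr ht).scaledTheta (N * (T - t) / (2 * Real.pi * r ^ 2)) x := by
  rw [ofReal_realTheta, PeriodPair.scaledTheta, dysonPeriods_ω₁]
  push_cast
  rfl

/-- A complex expression for the derivative of a real function is automatically real. This gives the
reality of the Weierstrass expressions at real points. -/
theorem HasDerivAt.ofReal_re {f : ℝ → ℝ} {f' : ℂ} {x : ℝ}
    (h : HasDerivAt (fun y ↦ (f y : ℂ)) f' x) : HasDerivAt f f'.re x ∧ (f'.re : ℂ) = f' := by
  have h1 : HasDerivAt f f'.re x := by
    simpa using! (reCLM.hasFDerivAt.comp_hasDerivAt x h)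
  exact ⟨h1, h1.ofReal_comp.unique h⟩

theorem realTheta_ne_zero {x : ℝ} (hx : (x : ℂ) ∉ (dysonPeriods hN hr ht).lattice) :
    realTheta N r T t x ≠ 0 := by
  have := PeriodPair.scaledTheta_ne_zero (modulus_pos hN hr ht) (dysonPeriods_ω₂ hN hr ht) hx
  rw [← ofReal_realTheta_eq_scaledTheta] at this
  exact_mod_cast this

theorem hasDerivAt_scaledTheta_dysonPeriods {z : ℂ} (hz : z ∉ (dysonPeriods hN hr ht).lattice) :
    HasDerivAt ((dysonPeriods hN hr ht).scaledTheta (N * (T - t) / (2 * Real.pi * r ^ 2)))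
      ((dysonPeriods hN hr ht).scaledTheta (N * (T - t) / (2 * Real.pi * r ^ 2)) z
        * periodicZeta hN hr ht z) z := by
  have hs := modulus_pos hN hr ht
  have h := PeriodPair.deriv_scaledTheta hs (dysonPeriods_ω₂ hN hr ht) hz
  have e : (dysonPeriods hN hr ht).weierstrassZeta z - 2 * (dysonPeriods hN hr ht).etaOne
      / (dysonPeriods hN hr ht).ω₁ * z = periodicZeta hN hr ht z := by
    have hpi : (Real.pi : ℂ) ≠ 0 := by exact_mod_cast Real.pi_ne_zero
    have hr' : (r : ℂ) ≠ 0 := by exact_mod_cast hr.ne'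
    rw [dysonPeriods_ω₁, periodicZeta]
    field
  rw [← e, ← h]
  exact (PeriodPair.differentiable_scaledTheta hs z).hasDerivAt

theorem hasDerivAt_thetaPotential_aux {x : ℝ} (hx : (x : ℂ) ∉ (dysonPeriods hN hr ht).lattice) :
    HasDerivAt (thetaPotential N r T t) (-(periodicZeta hN hr ht x).re) x ∧
      ((periodicZeta hN hr ht x).re : ℂ) = periodicZeta hN hr ht x := by
  have h0 := realTheta_ne_zero hN hr ht hx
  have h1 := (hasDerivAt_scaledTheta_dysonPeriods hN hr ht hx).comp_ofReal
  simp only [← ofReal_realTheta_eq_scaledTheta] at h1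
  obtain ⟨h2, h3⟩ := h1.ofReal_re
  rw [re_ofReal_mul] at h2 h3
  have h4 : ((periodicZeta hN hr ht x).re : ℂ) = periodicZeta hN hr ht x := by
    push_cast at h3
    exact mul_left_cancel₀ (by exact_mod_cast h0) h3
  refine ⟨(h2.log h0).neg.congr_deriv ?_, h4⟩
  field

theorem ofReal_thetaPotential' {x : ℝ} (hx : (x : ℂ) ∉ (dysonPeriods hN hr ht).lattice) :
    (thetaPotential' N r T t x : ℂ) = -periodicZeta hN hr ht x := by
  obtain ⟨h1, h2⟩ := hasDerivAt_thetaPotential_aux hN hr ht hx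
  rw [thetaPotential', h1.deriv]
  push_cast
  rw [h2]

theorem hasDerivAt_thetaPotential {x : ℝ} (hx : (x : ℂ) ∉ (dysonPeriods hN hr ht).lattice) :
    HasDerivAt (thetaPotential N r T t) (thetaPotential' N r T t x) x := by
  have h := (hasDerivAt_thetaPotential_aux hN hr ht hx).1
  exact h.differentiableAt.hasDerivAt

theorem hasDerivAt_thetaPotential'_aux {x : ℝ}
    (hx : (x : ℂ) ∉ (dysonPeriods hN hr ht).lattice) :
    HasDerivAt (fun y ↦ (thetaPotential' N r T t y : ℂ))
      ((dysonPeriods hN hr ht).weierstrassP x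
        + 1 / (Real.pi * r) * (dysonPeriods hN hr ht).etaOne) x := by
  have h := (hasDerivAt_periodicZeta hN hr ht hx).comp_ofReal.neg
  rw [neg_neg] at h
  refine h.congr_of_eventuallyEq ?_
  have hopen : ∀ᶠ y : ℝ in 𝓝 x, (y : ℂ) ∉ (dysonPeriods hN hr ht).lattice :=
    continuous_ofReal.continuousAt.eventually
      ((dysonPeriods hN hr ht).isClosed_lattice.isOpen_compl.mem_nhds hx)
  filter_upwards [hopen] with y hy
  exact ofReal_thetaPotential' hN hr ht hy

theorem hasDerivAt_thetaPotential' {x : ℝ} (hx : (x : ℂ) ∉ (dysonPeriods hN hr ht).lattice) :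
    HasDerivAt (thetaPotential' N r T t) (thetaPotential'' N r T t x) x :=
  (hasDerivAt_thetaPotential'_aux hN hr ht hx).ofReal_re.1.differentiableAt.hasDerivAt

theorem ofReal_thetaPotential'' {x : ℝ} (hx : (x : ℂ) ∉ (dysonPeriods hN hr ht).lattice) :
    (thetaPotential'' N r T t x : ℂ) = (dysonPeriods hN hr ht).weierstrassP x
        + 1 / (Real.pi * r) * (dysonPeriods hN hr ht).etaOne :=
  (hasDerivAt_thetaPotential' hN hr ht hx).ofReal_comp.unique
    (hasDerivAt_thetaPotential'_aux hN hr ht hx)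

/-- With θ' = θψ and ψ = -U', differentiating again gives θ'' = θ(ψ² + ψ'). -/
theorem jacobiThetaOneSecond_eq {x : ℝ} (hx : (x : ℂ) ∉ (dysonPeriods hN hr ht).lattice) :
    jacobiThetaOneSecond (x / (2 * Real.pi * r) : ℝ)
      (I * (N * (T - t) / (2 * Real.pi * r ^ 2) : ℝ)) / (2 * Real.pi * r) ^ 2
    = realTheta N r T t x * (thetaPotential' N r T t x ^ 2 - thetaPotential'' N r T t x) := by
  have hs := modulus_pos hN hr ht
  have hτ : 0 < im (I * (N * (T - t) / (2 * Real.pi * r ^ 2) : ℝ)) := by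
    simpa only [I_mul_im, ofReal_re] using hs
  set L := dysonPeriods hN hr ht
  set s := N * (T - t) / (2 * Real.pi * r ^ 2)
  have hω : L.ω₁ = 2 * Real.pi * r := dysonPeriods_ω₁ hN hr ht
  have hdiv (z : ℂ) : HasDerivAt (fun z ↦ z / L.ω₁) (1 / L.ω₁) z := (hasDerivAt_id z).div_const _
  have h1 (z : ℂ) : HasDerivAt (L.scaledTheta s)
      (jacobiThetaOneDeriv (z / L.ω₁) (I * s) * (1 / L.ω₁)) z :=
    HasDerivAt.comp (h₂ := fun v ↦ jacobiThetaOne v (I * s)) z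
      (hasDerivAt_jacobiThetaOne (z / L.ω₁) hτ) (hdiv z)
  have h2 : HasDerivAt (fun z ↦ jacobiThetaOneDeriv (z / L.ω₁) (I * s) * (1 / L.ω₁))
      (jacobiThetaOneSecond (x / L.ω₁) (I * s) * (1 / L.ω₁) * (1 / L.ω₁)) x :=
    ((hasDerivAt_jacobiThetaOneDeriv (x / L.ω₁) hτ).comp (x : ℂ) (hdiv x)).mul_const _
  have h3 := (hasDerivAt_scaledTheta_dysonPeriods hN hr ht hx).mul
    (hasDerivAt_periodicZeta hN hr ht hx)
  have h4 : (fun z ↦ jacobiThetaOneDeriv (z / L.ω₁) (I * s) * (1 / L.ω₁)) =ᶠ[𝓝 (x : ℂ)]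
      L.scaledTheta s * periodicZeta hN hr ht := by
    filter_upwards [L.isClosed_lattice.isOpen_compl.mem_nhds hx] with z hz
    exact (h1 z).unique (hasDerivAt_scaledTheta_dysonPeriods hN hr ht hz)
  have h5 := h2.unique (h3.congr_of_eventuallyEq h4)
  rw [ofReal_thetaPotential' hN hr ht hx, ofReal_thetaPotential'' hN hr ht hx,
    ofReal_realTheta_eq_scaledTheta hN hr ht]
  rw [hω] at h5
  push_cast
  linear_combination h5

theorem hasDerivAt_realTheta_time {x : ℝ} (hx : (x : ℂ) ∉ (dysonPeriods hN hr ht).lattice) :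
    HasDerivAt (fun t ↦ realTheta N r T t x) (-(N / 2) * (realTheta N r T t x
      * (thetaPotential' N r T t x ^ 2 - thetaPotential'' N r T t x))) t := by
  have hs := modulus_pos hN hr ht
  have hτ : 0 < im (I * (N * (T - t) / (2 * Real.pi * r ^ 2) : ℝ)) := by
    simpa only [I_mul_im, ofReal_re] using hs
  have hpi : (Real.pi : ℂ) ≠ 0 := by exact_mod_cast Real.pi_ne_zero
  have hr' : (r : ℂ) ≠ 0 := by exact_mod_cast hr.ne'
  have hI := I_ne_zero
  have h1 : HasDerivAt (fun t : ℝ ↦ N * (T - t) / (2 * Real.pi * r ^ 2))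
      (N * (-1) / (2 * Real.pi * r ^ 2)) t :=
    (((hasDerivAt_id t).const_sub T).const_mul _).div_const _
  have h2 := h1.ofReal_comp.const_mul I
  have h3 := (hasDerivAt_jacobiThetaOne_tau ((x / (2 * Real.pi * r) : ℝ) : ℂ) hτ).comp t h2
  -- The factors 1/(4πi) of the heat equation, -iN/(2πr²) of the modulus and (2πr)² of the scaling
  -- multiply to -N/2.
  have e : jacobiThetaOneSecond (x / (2 * Real.pi * r) : ℝ)
        (I * (N * (T - t) / (2 * Real.pi * r ^ 2) : ℝ)) / (4 * Real.pi * I)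
        * (I * ((N * (-1) / (2 * Real.pi * r ^ 2) : ℝ) : ℂ))
      = ((-(N / 2) * (realTheta N r T t x
      * (thetaPotential' N r T t x ^ 2 - thetaPotential'' N r T t x)) : ℝ) : ℂ) := by
    have h4 := jacobiThetaOneSecond_eq hN hr ht hx
    push_cast at h4 ⊢
    rw [← h4]
    field
  rw [e] at h3
  rw [show (fun τ ↦ jacobiThetaOne ((x / (2 * Real.pi * r) : ℝ) : ℂ) τ) ∘
    (fun t : ℝ ↦ I * (N * (T - t) / (2 * Real.pi * r ^ 2) : ℝ))
      = fun t ↦ (realTheta N r T t x : ℂ) from funext fun t ↦ (ofReal_realTheta N r T t x).symm] at h3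
  simpa only [ofReal_re] using h3.ofReal_re.1

theorem hasDerivAt_thetaPotential_time {x : ℝ}
    (hx : (x : ℂ) ∉ (dysonPeriods hN hr ht).lattice) :
    HasDerivAt (fun t ↦ thetaPotential N r T t x)
      (N / 2 * (thetaPotential' N r T t x ^ 2 - thetaPotential'' N r T t x)) t := by
  have h0 := realTheta_ne_zero hN hr ht hx
  refine ((hasDerivAt_realTheta_time hN hr ht hx).log h0).neg.congr_deriv ?_
  field

theorem thetaPotential_neg (N : ℕ) (r T t x : ℝ) :
    thetaPotential N r T t (-x) = thetaPotential N r T t x := by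
  rw [thetaPotential, neg_div, ofReal_neg, jacobiThetaOne_neg, neg_re, Real.log_neg_eq_log,
    thetaPotential]

theorem thetaPotential'_neg (N : ℕ) (r T t x : ℝ) :
    thetaPotential' N r T t (-x) = -thetaPotential' N r T t x := by
  have h := deriv_comp_neg (thetaPotential N r T t) x
  simp only [thetaPotential_neg] at h
  rw [thetaPotential', thetaPotential', h, neg_neg]

theorem thetaPotential''_neg (N : ℕ) (r T t x : ℝ) :
    thetaPotential'' N r T t (-x) = thetaPotential'' N r T t x := by
  have h := deriv_comp_neg (thetaPotential' N r T t) x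
  simp only [thetaPotential'_neg, deriv.fun_neg] at h
  rw [thetaPotential'', thetaPotential'']
  exact (neg_injective h).symm

/-- The corrections linear in the argument cancel in this combination. -/
theorem periodicZeta_addition {a b : ℂ} (ha : a ∉ (dysonPeriods hN hr ht).lattice)
    (hb : b ∉ (dysonPeriods hN hr ht).lattice) (hab : a + b ∉ (dysonPeriods hN hr ht).lattice) :
    (periodicZeta hN hr ht a + periodicZeta hN hr ht b - periodicZeta hN hr ht (a + b)) ^ 2
      = (dysonPeriods hN hr ht).weierstrassP a + (dysonPeriods hN hr ht).weierstrassP b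
        + (dysonPeriods hN hr ht).weierstrassP (a + b) := by
  rw [← PeriodPair.weierstrassZeta_addition _ ha hb hab]
  simp only [periodicZeta]
  ring

/-- The addition theorem in terms of the potential. -/
theorem thetaPotential'_addition {a b : ℝ} (ha : (a : ℂ) ∉ (dysonPeriods hN hr ht).lattice)
    (hb : (b : ℂ) ∉ (dysonPeriods hN hr ht).lattice)
    (hab : ((a + b : ℝ) : ℂ) ∉ (dysonPeriods hN hr ht).lattice) :
    (thetaPotential' N r T t a + thetaPotential' N r T t b - thetaPotential' N r T t (a + b)) ^ 2
      = thetaPotential'' N r T t a + thetaPotential'' N r T t b + thetaPotential'' N r T t (a + b)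
        - 3 * (1 / (Real.pi * r) * (dysonPeriods hN hr ht).etaOne.re) := by
  have hη : ((dysonPeriods hN hr ht).etaOne.re : ℂ) = (dysonPeriods hN hr ht).etaOne :=
    conj_eq_iff_re.1 (etaOne_dysonPeriods_conj hN hr ht)
  have h := periodicZeta_addition hN hr ht ha hb (by exact_mod_cast hab)
  rw [← ofReal_add] at h
  have e1 := ofReal_thetaPotential' hN hr ht ha
  have e2 := ofReal_thetaPotential' hN hr ht hb
  have e3 := ofReal_thetaPotential' hN hr ht hab
  have f1 := ofReal_thetaPotential'' hN hr ht ha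
  have f2 := ofReal_thetaPotential'' hN hr ht hb
  have f3 := ofReal_thetaPotential'' hN hr ht hab
  apply ofReal_injective
  rw [← hη] at f1 f2 f3
  rw [ofReal_pow, ofReal_sub, ofReal_sub, ofReal_add, ofReal_add, ofReal_add, e1, e2, e3, f1, f2,
    f3]
  push_cast at h ⊢
  linear_combination h

end Potential

end

/-! ### Pair sums and conjugation in one variable. -/

noncomputable section

open Filter Topology Finset

theorem sum_sum_Ioi_of_symm {N : ℕ} (f : Fin N → Fin N → ℝ) (hs : ∀ i k, f i k = f k i)
    (h0 : ∀ i, f i i = 0) : ∑ i, ∑ k, f i k = 2 * ∑ i, ∑ k ∈ Ioi i, f i k := by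
  have h1 (i : Fin N) : ∑ k, f i k = ∑ k ∈ Iio i, f i k + ∑ k ∈ Ioi i, f i k := by
    have hu : (univ : Finset (Fin N)) = insert i (Iio i ∪ Ioi i) := by
      ext k
      simp only [mem_univ, mem_insert, mem_union, mem_Iio, mem_Ioi, true_iff]
      exact (lt_trichotomy k i).elim (fun h ↦ .inr (.inl h)) fun h ↦ h.imp id .inr
    rw [hu, sum_insert (by simp), h0, zero_add, sum_union]
    exact disjoint_left.2 fun k h1 h2 ↦ (lt_asymm (mem_Iio.1 h1) (mem_Ioi.1 h2))
  have h2 : ∑ i, ∑ k ∈ Iio i, f i k = ∑ i, ∑ k ∈ Ioi i, f i k := by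
    rw [sum_comm' (t' := univ) (s' := fun k ↦ Ioi k) (by simp)]
    exact sum_congr rfl fun i _ ↦ sum_congr rfl fun k _ ↦ hs _ _
  simp only [h1, sum_add_distrib, h2]
  ring

/-- The sum of squared forces, for pair forces `A` that satisfy the addition theorem. -/
theorem sum_sq_sum_of_addition {N : ℕ} (A C : Fin N → Fin N → ℝ)
    (hA : ∀ j k, A j k = -A k j) (hC : ∀ j k, C j k = C k j) (hC0 : ∀ j, C j j = 0)
    (h : ∀ j k l, j ≠ k → k ≠ l → l ≠ j →
      (A j k + A k l + A l j) ^ 2 = C j k + C k l + C l j) :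
    ∑ j, (∑ k, A j k) ^ 2
      = N / 2 * ∑ j, ∑ k, A j k ^ 2 - ((N : ℝ) - 2) / 2 * ∑ j, ∑ k, C j k := by
  have hA0 (j : Fin N) : A j j = 0 := by linarith [hA j j]
  -- For distinct indices, antisymmetry makes the left side -(ab + bc + ca) with a, b, c the three
  -- cyclic forces, and the addition hypothesis supplies (a + b + c)². The indicator terms repair
  -- the triples with equal indices. The left side is one product in its three rotations, each with
  -- the same triple sum.
  have key (j k l : Fin N) : A j k * A j l + A k j * A k l + A l j * A l k
      = (A j k ^ 2 + A k l ^ 2 + A l j ^ 2 - C j k - C k l - C l j) / 2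
        + (if j = k then C l j else 0) + (if k = l then C j l else 0)
        + (if l = j then C j k else 0) := by
    by_cases h1 : j = k
    · subst h1
      by_cases h2 : j = l
      · subst h2
        simp [hA0, hC0]
      · rw [if_pos rfl, if_neg h2, if_neg (Ne.symm h2), hA0, hC0, hA j l, hC j l]
        ring
    by_cases h2 : k = l
    · subst h2
      rw [if_neg h1, if_pos rfl, if_neg (Ne.symm h1), hA0, hC0, hA k j, hC k j]
      ring
    by_cases h3 : l = j
    · subst h3
      rw [if_neg h1, if_neg h2, if_pos rfl, hA0, hC0, hA k l, hC k l]
      ring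
    have := h j k l h1 h2 h3
    rw [if_neg h1, if_neg h2, if_neg h3, hA k j, hA l k, hA j l]
    linear_combination -this / 2
  have hT (B : Fin N → Fin N → ℝ) : ∑ j, ∑ k, ∑ _l : Fin N, B j k = N * ∑ j, ∑ k, B j k := by
    simp [mul_sum]
  have hT2 (B : Fin N → Fin N → ℝ) : ∑ _j : Fin N, ∑ k, ∑ l, B k l = N * ∑ j, ∑ k, B j k := by
    simp
  have hT3 (B : Fin N → Fin N → ℝ) : ∑ j, ∑ _k : Fin N, ∑ l, B l j = N * ∑ j, ∑ k, B j k := by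
    simp only [sum_const, card_univ, Fintype.card_fin, nsmul_eq_mul, ← mul_sum]
    rw [sum_comm]
  have hS : ∑ j, (∑ k, A j k) ^ 2 = ∑ j, ∑ k, ∑ l, A j k * A j l := by
    refine sum_congr rfl fun j _ ↦ ?_
    rw [sq, sum_mul_sum]
  have hS2 : ∑ j, (∑ k, A j k) ^ 2 = ∑ j, ∑ k, ∑ l, A k j * A k l := by
    rw [hS, sum_comm]
  have hS3 : ∑ j, (∑ k, A j k) ^ 2 = ∑ j, ∑ k, ∑ l, A l j * A l k := by
    rw [hS, sum_comm]
    refine sum_congr rfl fun k _ ↦ ?_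
    rw [sum_comm]
  have e1 : ∑ j, ∑ k, ∑ l, (if j = k then C l j else 0) = ∑ j, ∑ k, C j k := by
    rw [sum_comm (f := fun j k ↦ C j k)]
    refine sum_congr rfl fun j _ ↦ ?_
    rw [sum_comm]
    simp
  have e2 : ∑ j, ∑ k, ∑ l, (if k = l then C j l else 0) = ∑ j, ∑ k, C j k := by simp
  have e3 : ∑ j, ∑ k, ∑ l, (if l = j then C j k else 0) = ∑ j, ∑ k, C j k := by simp
  have hsum : ∑ j, ∑ k, ∑ l, (A j k * A j l + A k j * A k l + A l j * A l k)
      = ∑ j, ∑ k, ∑ l, ((A j k ^ 2 + A k l ^ 2 + A l j ^ 2 - C j k - C k l - C l j) / 2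
        + (if j = k then C l j else 0) + (if k = l then C j l else 0)
        + (if l = j then C j k else 0)) :=
    sum_congr rfl fun j _ ↦ sum_congr rfl fun k _ ↦ sum_congr rfl fun l _ ↦ key j k l
  simp only [sum_add_distrib, sum_sub_distrib, ← sum_div, e1, e2, e3] at hsum
  rw [← hS, ← hS2, ← hS3, hT (fun j k ↦ A j k ^ 2), hT2 (fun j k ↦ A j k ^ 2),
    hT3 (fun j k ↦ A j k ^ 2), hT C, hT2 C, hT3 C] at hsum
  linear_combination hsum / 3

/-- Conjugation of the one-dimensional Kolmogorov operator. -/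
theorem exp_mul_kolmogorov_conj {β a w₂ : ℝ} {h w w₁ : ℝ → ℝ} (hh : ContDiffAt ℝ 2 h a)
    (hw : ∀ᶠ s in 𝓝 a, HasDerivAt w (w₁ s) s) (hw₁ : HasDerivAt w₁ w₂ a) :
    Real.exp (β * w a / 2) * (1 / 2 * deriv (deriv fun s ↦ Real.exp (-β * w s / 2) * h s) a
        + β / 2 * deriv (fun s ↦ deriv w s * (Real.exp (-β * w s / 2) * h s)) a)
      = 1 / 2 * deriv (deriv h) a + β / 4 * w₂ * h a - β ^ 2 / 8 * w₁ a ^ 2 * h a := by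
  have hh1 : ∀ᶠ s in 𝓝 a, HasDerivAt h (deriv h s) s :=
    ((hh.eventually (by simp)).mono fun s hs ↦ (hs.differentiableAt (by simp)).hasDerivAt)
  have hh2 : HasDerivAt (deriv h) (deriv (deriv h) a) a :=
    ((hh.derivWithin (m := 1) (by norm_num)).differentiableAt (by simp)).hasDerivAt
  have hE {s : ℝ} (hs : HasDerivAt w (w₁ s) s) : HasDerivAt (fun s ↦ Real.exp (-β * w s / 2))
      (Real.exp (-β * w s / 2) * (-β * w₁ s / 2)) s := ((hs.const_mul (-β)).div_const 2).exp
  have hF : ∀ᶠ s in 𝓝 a, HasDerivAt (fun s ↦ Real.exp (-β * w s / 2) * h s)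
      (Real.exp (-β * w s / 2) * (-β * w₁ s / 2) * h s + Real.exp (-β * w s / 2) * deriv h s) s := by
    filter_upwards [hw, hh1] with s h1 h2
    exact (hE h1).mul h2
  have hEa := hE hw.self_of_nhds
  have d1 : deriv (deriv fun s ↦ Real.exp (-β * w s / 2) * h s) a = _ :=
    (((hEa.mul ((hw₁.const_mul (-β)).div_const 2)).mul hh1.self_of_nhds).add
      (hEa.mul hh2)).congr_of_eventuallyEq (hF.mono fun s hs ↦ hs.deriv) |>.deriv
  have d2 : deriv (fun s ↦ deriv w s * (Real.exp (-β * w s / 2) * h s)) a = _ :=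
    (hw₁.mul (hEa.mul hh1.self_of_nhds)).congr_of_eventuallyEq
      (hw.mono fun s hs ↦ by rw [hs.deriv]; rfl) |>.deriv
  have he : Real.exp (β * w a / 2) * Real.exp (-β * w a / 2) = 1 := by
    rw [← Real.exp_add]
    ring_nf
    simp
  rw [d1, d2]
  simp only [Pi.mul_apply]
  -- The terms in w₁h' cancel. The coefficients of w₂h and w₁²h are -β/4 + β/2 and β²/8 - β²/4.
  linear_combination (1 / 2 * deriv (deriv h) a + β / 4 * w₂ * h a - β ^ 2 / 8 * w₁ a ^ 2 * h a) * he

theorem coordDeriv_update {N : ℕ} (j : Fin N) (f : (Fin N → ℝ) → ℝ) (x : Fin N → ℝ) (s : ℝ) :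
    coordDeriv j f (Function.update x j s) = deriv (fun s ↦ f (Function.update x j s)) s := by
  simp [coordDeriv]

theorem coordDeriv_coordDeriv {N : ℕ} (j : Fin N) (f : (Fin N → ℝ) → ℝ) (x : Fin N → ℝ) :
    coordDeriv j (coordDeriv j f) x
      = deriv (deriv fun s ↦ f (Function.update x j s)) (x j) := by
  rw [coordDeriv]
  simp only [coordDeriv_update]

theorem isOpen_regularConfigurations (N : ℕ) (r : ℝ) (hr : 0 < r) :
    IsOpen (regularConfigurations N r) := by
  have hc : IsClosed (Set.range fun m : ℤ ↦ 2 * Real.pi * r * m) := by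
    have h : 2 * Real.pi * r ≠ 0 := by
      have := Real.pi_pos
      positivity
    exact ((Homeomorph.mulLeft₀ _ h).isClosedEmbedding.comp
      Int.isClosedEmbedding_coe_real).isClosed_range
  have e : regularConfigurations N r = (⋂ j, ⋂ k, ⋂ (_ : j < k),
      (fun x : Fin N → ℝ ↦ x k - x j) ⁻¹' (Set.range fun m : ℤ ↦ 2 * Real.pi * r * m)ᶜ)
      ∩ (shiftedSum r) ⁻¹' (Set.range fun m : ℤ ↦ 2 * Real.pi * r * m)ᶜ := by
    ext x
    simp [regularConfigurations, eq_comm]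
  have hsum : Continuous (shiftedSum (N := N) r) := by
    unfold shiftedSum
    fun_prop
  rw [e]
  refine IsOpen.inter (isOpen_iInter_of_finite fun j ↦ isOpen_iInter_of_finite fun k ↦
    isOpen_iInter_of_finite fun _ ↦ hc.isOpen_compl.preimage (by fun_prop))
    (hc.isOpen_compl.preimage hsum)

/-! ### Gradient, Laplacian and time derivative of W. -/

section Configurations

variable {N : ℕ} {r T t : ℝ} (hN : 2 ≤ N) (hr : 0 < r) (ht : t < T) {x : Fin N → ℝ}

theorem notMem_lattice_of_ne (hx : x ∈ regularConfigurations N r) {j k : Fin N} (hjk : j ≠ k) :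
    ((x k - x j : ℝ) : ℂ) ∉ (dysonPeriods hN hr ht).lattice := by
  rcases hjk.lt_or_gt with h | h
  · exact ofReal_notMem_lattice hN hr ht (hx.1 j k h)
  · intro hmem
    refine ofReal_notMem_lattice hN hr ht (hx.1 k j h) ?_
    simpa using neg_mem hmem

theorem notMem_lattice_shiftedSum (hx : x ∈ regularConfigurations N r) :
    ((shiftedSum r x : ℝ) : ℂ) ∉ (dysonPeriods hN hr ht).lattice :=
  ofReal_notMem_lattice hN hr ht hx.2

/-- The increment of the `i`-th coordinate under a unit shift of the `j`-th one. -/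
def coordUnit {N : ℕ} (j i : Fin N) : ℝ := if i = j then 1 else 0

/-- The gradient of `W_N`. -/
def potentialGradient {N : ℕ} (r T t : ℝ) (j : Fin N) (x : Fin N → ℝ) : ℝ :=
  ∑ i, ∑ k ∈ Ioi i, thetaPotential' N r T t (x k - x i) * (coordUnit j k - coordUnit j i)
    + thetaPotential' N r T t (shiftedSum r x)

theorem hasDerivAt_update_apply (j i : Fin N) (x : Fin N → ℝ) (s : ℝ) :
    HasDerivAt (fun s ↦ Function.update x j s i) (coordUnit j i) s := by
  by_cases h : i = j
  · subst h
    simpa [coordUnit] using! hasDerivAt_id s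
  · simpa [coordUnit, h] using hasDerivAt_const s (x i)

theorem hasDerivAt_shiftedSum_update (j : Fin N) (x : Fin N → ℝ) (s : ℝ) :
    HasDerivAt (fun s ↦ shiftedSum r (Function.update x j s)) 1 s := by
  have h := (HasDerivAt.fun_sum (u := univ) fun i _ ↦ hasDerivAt_update_apply j i x s).sub_const
    (kappaShift N r)
  refine h.congr_deriv ?_
  simp [coordUnit]

theorem hasDerivAt_dysonPotential (hN : 2 ≤ N) (hr : 0 < r) (ht : t < T) (j : Fin N) {s : ℝ}
    (hx : Function.update x j s ∈ regularConfigurations N r) :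
    HasDerivAt (fun s ↦ dysonPotential r T t (Function.update x j s))
      (potentialGradient r T t j (Function.update x j s)) s := by
  refine HasDerivAt.add (HasDerivAt.fun_sum fun i _ ↦ HasDerivAt.fun_sum fun k hk ↦ ?_) ?_
  · exact HasDerivAt.comp (h₂ := thetaPotential N r T t) s (hasDerivAt_thetaPotential hN hr ht
      (notMem_lattice_of_ne hN hr ht hx (mem_Ioi.1 hk).ne))
      ((hasDerivAt_update_apply j k x s).sub (hasDerivAt_update_apply j i x s))
  · simpa using! (hasDerivAt_thetaPotential hN hr ht (notMem_lattice_shiftedSum hN hr ht hx)).comp s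
      (hasDerivAt_shiftedSum_update j x s)

theorem hasDerivAt_potentialGradient (hN : 2 ≤ N) (hr : 0 < r) (ht : t < T) (j : Fin N)
    (hx : x ∈ regularConfigurations N r) :
    HasDerivAt (fun s ↦ potentialGradient r T t j (Function.update x j s))
      (∑ i, ∑ k ∈ Ioi i, thetaPotential'' N r T t (x k - x i)
        * (coordUnit j k - coordUnit j i) ^ 2 + thetaPotential'' N r T t (shiftedSum r x)) (x j) := by
  have hx' : Function.update x j (x j) ∈ regularConfigurations N r := by simpa using hx
  refine HasDerivAt.add (HasDerivAt.fun_sum fun i _ ↦ HasDerivAt.fun_sum fun k hk ↦ ?_) ?_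
  · have h := ((hasDerivAt_thetaPotential' hN hr ht
      (notMem_lattice_of_ne hN hr ht hx' (mem_Ioi.1 hk).ne)).comp (x j)
      ((hasDerivAt_update_apply j k x (x j)).sub (hasDerivAt_update_apply j i x (x j)))).mul_const
      (coordUnit j k - coordUnit j i)
    refine h.congr_deriv ?_
    rw [Function.update_eq_self]
    ring
  · have h := (hasDerivAt_thetaPotential' hN hr ht
      (notMem_lattice_shiftedSum hN hr ht hx')).comp (x j) (hasDerivAt_shiftedSum_update j x (x j))
    rw [Function.update_eq_self, mul_one] at h
    exact h

theorem hasDerivAt_dysonPotential_time (hN : 2 ≤ N) (hr : 0 < r) (ht : t < T)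
    (hx : x ∈ regularConfigurations N r) :
    HasDerivAt (fun t ↦ dysonPotential r T t x) (N / 2 *
      (∑ i, ∑ k ∈ Ioi i, thetaPotential' N r T t (x k - x i) ^ 2
        + thetaPotential' N r T t (shiftedSum r x) ^ 2
        - ∑ i, ∑ k ∈ Ioi i, thetaPotential'' N r T t (x k - x i)
        - thetaPotential'' N r T t (shiftedSum r x))) t := by
  have h := (HasDerivAt.fun_sum (u := univ) fun i _ ↦ HasDerivAt.fun_sum (u := Ioi i) fun k hk ↦
    hasDerivAt_thetaPotential_time hN hr ht
      (notMem_lattice_of_ne hN hr ht hx (mem_Ioi.1 hk).ne)).add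
    (hasDerivAt_thetaPotential_time hN hr ht (notMem_lattice_shiftedSum hN hr ht hx))
  refine h.congr_deriv ?_
  simp only [← mul_sum, sum_sub_distrib]
  ring

/-- Each pair depends on two coordinates and so contributes U'' twice to the Laplacian. -/
theorem sum_coordUnit_sub_sq {i k : Fin N} (h : i ≠ k) :
    ∑ j, (coordUnit j k - coordUnit j i) ^ 2 = 2 := by
  have e (j : Fin N) : (coordUnit j k - coordUnit j i) ^ 2
      = (if k = j then 1 else 0) + (if i = j then 1 else 0) := by
    unfold coordUnit
    split_ifs with h1 h2
    · exact absurd (h2.trans h1.symm) h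
    all_goals norm_num
  simp only [e, sum_add_distrib, sum_ite_eq, mem_univ, if_true]
  norm_num

/-- Oddness fixes the value that `deriv` assigns at the singular point, so force sums may include
the diagonal. -/
theorem thetaPotential'_zero (N : ℕ) (r T t : ℝ) : thetaPotential' N r T t 0 = 0 := by
  have := thetaPotential'_neg N r T t 0
  rw [neg_zero] at this
  linarith

theorem potentialGradient_eq (r T t : ℝ) (j : Fin N) (x : Fin N → ℝ) :
    potentialGradient r T t j x = ∑ k, thetaPotential' N r T t (x j - x k)
      + thetaPotential' N r T t (shiftedSum r x) := by
  have hneg (a b : ℝ) : thetaPotential' N r T t (a - b) = -thetaPotential' N r T t (b - a) := by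
    rw [← thetaPotential'_neg, neg_sub]
  have h := sum_sum_Ioi_of_symm
    (fun i k ↦ thetaPotential' N r T t (x k - x i) * (coordUnit j k - coordUnit j i))
    (fun i k ↦ by rw [hneg]; ring) (fun i ↦ by simp)
  have h1 : ∑ i, ∑ k, thetaPotential' N r T t (x k - x i) * (coordUnit j k - coordUnit j i)
      = 2 * ∑ k, thetaPotential' N r T t (x j - x k) := by
    simp only [mul_sub, sum_sub_distrib]
    have e1 : ∑ i, ∑ k, thetaPotential' N r T t (x k - x i) * coordUnit j k
        = ∑ k, thetaPotential' N r T t (x j - x k) := by simp [coordUnit]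
    have e2 : ∑ i, ∑ k, thetaPotential' N r T t (x k - x i) * coordUnit j i
        = -∑ k, thetaPotential' N r T t (x j - x k) := by
      rw [sum_comm, ← sum_neg_distrib]
      refine sum_congr rfl fun k _ ↦ ?_
      rw [← hneg]
      simp [coordUnit]
    rw [e1, e2]
    ring
  rw [h1] at h
  rw [potentialGradient]
  linear_combination -h / 2

theorem sum_potentialGradient_sq (hx : x ∈ regularConfigurations N r) :
    ∑ j, potentialGradient r T t j x ^ 2
      = N * ∑ i, ∑ k ∈ Ioi i, thetaPotential' N r T t (x k - x i) ^ 2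
        - ((N : ℝ) - 2) * ∑ i, ∑ k ∈ Ioi i, thetaPotential'' N r T t (x k - x i)
        + N * ((N : ℝ) - 1) * ((N : ℝ) - 2) / 2
          * (1 / (Real.pi * r) * (dysonPeriods hN hr ht).etaOne.re)
        + N * thetaPotential' N r T t (shiftedSum r x) ^ 2 := by
  set e := 1 / (Real.pi * r) * (dysonPeriods hN hr ht).etaOne.re with he
  set A : Fin N → Fin N → ℝ := fun j k ↦ thetaPotential' N r T t (x j - x k) with hAdef
  -- The constant -3e of the addition theorem is shared equally by the three pairs. Over the N(N-1)
  -- ordered pairs, weighted by -(N-2)/2, these shifts add up to the ground-energy constant.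
  set C : Fin N → Fin N → ℝ := fun j k ↦
    if j = k then 0 else thetaPotential'' N r T t (x j - x k) - e with hCdef
  have hA (j k : Fin N) : A j k = -A k j := by
    simp only [hAdef]
    rw [← thetaPotential'_neg, neg_sub]
  have hA0 (j : Fin N) : A j j = 0 := by simp [hAdef, thetaPotential'_zero]
  have hU (a b : ℝ) : thetaPotential'' N r T t (a - b) = thetaPotential'' N r T t (b - a) := by
    rw [← thetaPotential''_neg, neg_sub]
  have hC (j k : Fin N) : C j k = C k j := by
    simp only [hCdef, eq_comm (a := j) (b := k), hU (x j)]
  have hC0 (j : Fin N) : C j j = 0 := by simp [hCdef]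
  have hadd (j k l : Fin N) (h1 : j ≠ k) (h2 : k ≠ l) (h3 : l ≠ j) :
      (A j k + A k l + A l j) ^ 2 = C j k + C k l + C l j := by
    have h := thetaPotential'_addition hN hr ht (a := x j - x k) (b := x k - x l)
      (notMem_lattice_of_ne hN hr ht hx h1.symm) (notMem_lattice_of_ne hN hr ht hx h2.symm)
      (by rw [sub_add_sub_cancel]; exact notMem_lattice_of_ne hN hr ht hx h3)
    rw [sub_add_sub_cancel, ← he] at h
    rw [hA l j]
    simp only [hAdef, hCdef, if_neg h1, if_neg h2, if_neg h3]
    rw [hU (x l)]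
    linear_combination h
  have h := sum_sq_sum_of_addition A C hA hC hC0 hadd
  have hA2 := sum_sum_Ioi_of_symm (fun i k ↦ A i k ^ 2) (fun i k ↦ by rw [hA, neg_sq])
    (fun i ↦ by simp [hA0])
  have hC2 := sum_sum_Ioi_of_symm C hC hC0
  have hA3 : ∑ i, ∑ k ∈ Ioi i, A i k ^ 2
      = ∑ i, ∑ k ∈ Ioi i, thetaPotential' N r T t (x k - x i) ^ 2 :=
    sum_congr rfl fun i _ ↦ sum_congr rfl fun k _ ↦ by rw [hA, neg_sq]
  have hcard : ∑ i : Fin N, ∑ _k ∈ Ioi i, (1 : ℝ) = N * ((N : ℝ) - 1) / 2 := by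
    have h1 := sum_sum_Ioi_of_symm (fun i k : Fin N ↦ if i = k then (0 : ℝ) else 1)
      (fun i k ↦ by simp [eq_comm]) (by simp)
    have h2 : ∑ i : Fin N, ∑ k ∈ Ioi i, (if i = k then (0 : ℝ) else 1)
        = ∑ i : Fin N, ∑ _k ∈ Ioi i, (1 : ℝ) :=
      sum_congr rfl fun i _ ↦ sum_congr rfl fun k hk ↦ if_neg (mem_Ioi.1 hk).ne
    have h3 : ∑ i : Fin N, ∑ k, (if i = k then (0 : ℝ) else 1) = N * ((N : ℝ) - 1) := by
      have h4 (i k : Fin N) : (if i = k then (0 : ℝ) else 1) = 1 - if i = k then 1 else 0 := by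
        split_ifs <;> simp
      simp only [h4, sum_sub_distrib]
      simp
      ring
    rw [h3, h2] at h1
    linear_combination -h1 / 2
  have hC3 : ∑ i, ∑ k ∈ Ioi i, C i k
      = ∑ i, ∑ k ∈ Ioi i, thetaPotential'' N r T t (x k - x i) - e * (N * ((N : ℝ) - 1) / 2) := by
    rw [← hcard]
    simp only [mul_sum, mul_one, ← sum_sub_distrib]
    refine sum_congr rfl fun i _ ↦ sum_congr rfl fun k hk ↦ ?_
    simp only [hCdef, if_neg (mem_Ioi.1 hk).ne, hU (x i)]
  -- Action and reaction cancel, which kills the cross terms with the force at x̄.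
  have h0 : ∑ j, ∑ k, A j k = 0 := by
    have h1 : ∑ j, ∑ k, A j k = -∑ j, ∑ k, A j k := by
      conv_lhs => rw [sum_comm]
      rw [← sum_neg_distrib]
      refine sum_congr rfl fun j _ ↦ ?_
      rw [← sum_neg_distrib]
      exact sum_congr rfl fun k _ ↦ hA k j
    linarith
  have hexp (j : Fin N) : potentialGradient r T t j x ^ 2 = (∑ k, A j k) ^ 2
      + 2 * thetaPotential' N r T t (shiftedSum r x) * ∑ k, A j k
      + thetaPotential' N r T t (shiftedSum r x) ^ 2 := by
    rw [potentialGradient_eq]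
    ring
  simp only [hexp, sum_add_distrib, ← mul_sum, h0]
  rw [h, hA2, hC2, hA3, hC3]
  simp
  ring

end Configurations

end

/-! ### Assembly of the conjugation identity and the Weierstrass form. -/

theorem lemma3p1 {N : ℕ} (hN : 2 ≤ N) {r T β : ℝ} (hr : 0 < r) (hβ : 0 < β)
    {t : ℝ} (ht : t ∈ Set.Ico 0 T) :
    -- the ground energy, an identity of complex numbers (so that `η₁` is real if `N ≥ 3`)
    ((groundEnergy β hN hr ht.2 : ℝ) : ℂ) =
        -((β : ℂ) ^ 2 / 16) * N * ((N : ℂ) - 1) * ((N : ℂ) - 2) * (1 / ((Real.pi : ℂ) * r))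
          * (dysonPeriods hN hr ht.2).etaOne ∧
    ∀ x ∈ regularConfigurations N r,
      -- the conjugation identity of operators, applied to a function `g` of class `C^{1,2}`
      (∀ g : ℝ → (Fin N → ℝ) → ℝ,
        DifferentiableWithinAt ℝ (fun s => g s x) (Set.Ico 0 T) t →
        ContDiffAt ℝ 2 (g t) x →
        Real.exp (β * dysonPotential r T t x / 2) *
            (timeDeriv T (fun s y => Real.exp (-β * dysonPotential r T s y / 2) * g s y) t x
              - kolmogorovOp β r T t
                  (fun y => Real.exp (-β * dysonPotential r T t y / 2) * g t y) x)
          = timeDeriv T g t x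
              + (hamiltonianOp β r T t (g t) x - groundEnergy β hN hr ht.2 * g t x)) ∧
      -- the expression of the interaction through `ζ`, `℘` and `η₁`
      ((interaction β r T t x : ℝ) : ℂ) =
        (β : ℂ) * (β - 2) / 8 * N *
          (∑ j, ∑ k ∈ Finset.Ioi j,
              ((dysonPeriods hN hr ht.2).weierstrassZeta ((x k - x j : ℝ) : ℂ)
                - ((x k - x j : ℝ) : ℂ) / (Real.pi * r) * (dysonPeriods hN hr ht.2).etaOne) ^ 2
            + ((dysonPeriods hN hr ht.2).weierstrassZeta ((shiftedSum r x : ℝ) : ℂ)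
                - ((shiftedSum r x : ℝ) : ℂ) / (Real.pi * r)
                  * (dysonPeriods hN hr ht.2).etaOne) ^ 2
            - ((N : ℂ) - 2) / N *
              ∑ j, ∑ k ∈ Finset.Ioi j,
                ((dysonPeriods hN hr ht.2).weierstrassP ((x k - x j : ℝ) : ℂ)
                  + 1 / (Real.pi * r) * (dysonPeriods hN hr ht.2).etaOne)) := by
  have hη : ((dysonPeriods hN hr ht.2).etaOne.re : ℂ) = (dysonPeriods hN hr ht.2).etaOne :=
    Complex.conj_eq_iff_re.1 (etaOne_dysonPeriods_conj hN hr ht.2)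
  have hN0 : (N : ℝ) ≠ 0 := by
    have : N ≠ 0 := by omega
    exact_mod_cast this
  refine ⟨?_, fun x hx ↦ ⟨fun g hg hg2 ↦ ?_, ?_⟩⟩
  · rw [groundEnergy]
    push_cast
    rw [hη]
  · have hW := hasDerivAt_dysonPotential_time hN hr ht.2 hx
    have hexp : Real.exp (β * dysonPotential r T t x / 2)
        * Real.exp (-β * dysonPotential r T t x / 2) = 1 := by
      rw [← Real.exp_add]
      ring_nf
      simp
    -- W is differentiable in t from both sides even at 0; only g is one-sided there. Derivatives
    -- within [0, T) are unique, so the product rule determines the value.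
    have htime : timeDeriv T (fun s y ↦ Real.exp (-β * dysonPotential r T s y / 2) * g s y) t x
        = _ :=
      ((((hW.const_mul (-β)).div_const 2).exp.hasDerivWithinAt).mul
        hg.hasDerivWithinAt).derivWithin (uniqueDiffOn_Ico 0 T t ht)
    have hgt : timeDeriv T g t x = derivWithin (fun s ↦ g s x) (Set.Ico 0 T) t := rfl
    have hconj (j : Fin N) := exp_mul_kolmogorov_conj (β := β) (a := x j)
      (h := fun s ↦ g t (Function.update x j s))
      (w := fun s ↦ dysonPotential r T t (Function.update x j s))
      (w₁ := fun s ↦ potentialGradient r T t j (Function.update x j s))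
      (by
        have hu : ContDiff ℝ 2 (fun s ↦ Function.update x j s) := contDiff_update 2 x j
        exact ContDiffAt.comp (x j) (by simpa using hg2) hu.contDiffAt)
      (by
        have hu : Continuous (fun s ↦ Function.update x j s) := continuous_const.update j continuous_id
        filter_upwards [(hu.continuousAt (x := x j)).eventually ((isOpen_regularConfigurations N r
          hr).mem_nhds (by simpa using hx))] with s hs
        exact hasDerivAt_dysonPotential hN hr ht.2 j hs)
      (hasDerivAt_potentialGradient hN hr ht.2 j hx)
    have hK : Real.exp (β * dysonPotential r T t x / 2) * kolmogorovOp β r T t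
        (fun y ↦ Real.exp (-β * dysonPotential r T t y / 2) * g t y) x
        = ∑ j, (1 / 2 * coordDeriv j (coordDeriv j (g t)) x
          + β / 4 * (∑ i, ∑ k ∈ Finset.Ioi i, thetaPotential'' N r T t (x k - x i)
            * (coordUnit j k - coordUnit j i) ^ 2 + thetaPotential'' N r T t (shiftedSum r x))
            * g t x
          - β ^ 2 / 8 * potentialGradient r T t j x ^ 2 * g t x) := by
      rw [kolmogorovOp, Finset.mul_sum, Finset.mul_sum, ← Finset.sum_add_distrib, Finset.mul_sum]
      refine Finset.sum_congr rfl fun j _ ↦ ?_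
      have h := hconj j
      simp only [Function.update_eq_self] at h
      rw [coordDeriv_coordDeriv, coordDeriv_coordDeriv, ← h, coordDeriv]
      simp only [coordDeriv_update]
    have hlap : ∑ j : Fin N, ∑ i, ∑ k ∈ Finset.Ioi i, thetaPotential'' N r T t (x k - x i)
        * (coordUnit j k - coordUnit j i) ^ 2
        = 2 * ∑ i, ∑ k ∈ Finset.Ioi i, thetaPotential'' N r T t (x k - x i) := by
      rw [Finset.sum_comm, Finset.mul_sum]
      refine Finset.sum_congr rfl fun i _ ↦ ?_
      rw [Finset.sum_comm, Finset.mul_sum]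
      refine Finset.sum_congr rfl fun k hk ↦ ?_
      rw [← Finset.mul_sum, sum_coordUnit_sub_sq (Finset.mem_Ioi.1 hk).ne, mul_comm]
    simp only [Finset.sum_add_distrib, Finset.sum_sub_distrib, ← Finset.sum_mul, ← Finset.mul_sum,
      hlap, sum_potentialGradient_sq hN hr ht.2 hx] at hK
    rw [mul_sub, hK, htime, hgt, hamiltonianOp, interaction, groundEnergy]
    simp only [Finset.sum_const, Finset.card_univ, Fintype.card_fin, nsmul_eq_mul]
    generalize ∑ i, ∑ k ∈ Finset.Ioi i, thetaPotential'' N r T t (x k - x i) = S₂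
    generalize ∑ i, ∑ k ∈ Finset.Ioi i, thetaPotential' N r T t (x k - x i) ^ 2 = S₁
    generalize ∑ j, coordDeriv j (coordDeriv j (g t)) x = Δ
    generalize derivWithin (fun s ↦ g s x) (Set.Ico 0 T) t = g'
    -- The prefactor N of the interaction cancels the denominator of (N-2)/N.
    have e1 : ((N : ℝ) - 2) / N * S₂ * N = (N - 2) * S₂ := by field
    generalize ((N : ℝ) - 2) / N * S₂ = S₃ at e1 ⊢
    -- The U''(x̄) terms from ∂ₜW and ΔW cancel. The squared forces have coefficient -βN/4 + β²N/8,
    -- and S₂ has βN/4 - β/2 - β²(N-2)/8; both carry the factor β(β-2)/8.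
    linear_combination (-β / 2 * (N / 2 * (S₁ + thetaPotential' N r T t (shiftedSum r x) ^ 2 - S₂
      - thetaPotential'' N r T t (shiftedSum r x))) * g t x + g') * hexp
      + β * (β - 2) / 8 * g t x * e1
  · rw [interaction]
    push_cast
    congr 2
    · congr 1
      · refine Finset.sum_congr rfl fun j _ ↦ Finset.sum_congr rfl fun k hk ↦ ?_
        have h := ofReal_thetaPotential' hN hr ht.2
          (notMem_lattice_of_ne hN hr ht.2 hx (Finset.mem_Ioi.1 hk).ne)
        rw [h, neg_sq, periodicZeta]
        push_cast
        rfl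
      · rw [ofReal_thetaPotential' hN hr ht.2 (notMem_lattice_shiftedSum hN hr ht.2 hx), neg_sq,
          periodicZeta]
    · congr 1
      refine Finset.sum_congr rfl fun j _ ↦ Finset.sum_congr rfl fun k hk ↦ ?_
      have h := ofReal_thetaPotential'' hN hr ht.2
        (notMem_lattice_of_ne hN hr ht.2 hx (Finset.mem_Ioi.1 hk).ne)
      rw [h]
      push_cast
      rfl
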